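/- Let $\Delta\subset\mathbb R^2$ be a convex polygon with integer vertices that has an interior lattice point. Let $\phi(x,y)=\sum_{(a,b)\in\partial\Delta\cap\mathbb Z^2}m_{a,b}x^ay^b$ be the Laurent polynomial with $m_{a,b}=1$ at the vertices whose restriction to each edge of lattice length $\kappa$ is, up to a monomial, $(1+\tau)^{\kappa}$, where $\tau$ is the monomial of the primitive vector of the edge. For complex numbers $\underline\lambda=(\lambda_j)$ indexed by the interior lattice points $(v_j,w_j)$ of $\Delta$ put $$\Phi_{\underline\lambda}(x,y)=\phi(x,y)-\sum_j\lambda_jx^{v_j}y^{w_j},\qquad C^*_{\underline\lambda}=\{(x,y)\in(\mathbb C^*)^2:\Phi_{\underline\lambda}(x,y)=0\}.$$ Let $p_m$ be a vertex of $\Delta$. Choose the (unique) basis $u,v$ of $\mathbb Z^2$ with $\det(u,v)=1$ such that $u$ is the primitive vector of the edge that leaves $p_m$ counterclockwise, $\Delta\subset p_m+\mathbb R_{\ge0}u+\mathbb R_{\ge0}v$, and $p_m+u+v$ is an interior point of $\Delta$; let $\ell$ be the index of this interior point. Let $X=x^{u_1}y^{u_2}$ and $Y=x^{v_1}y^{v_2}$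 be the corresponding toric coordinates, and let $c=|\Delta\cap\mathbb Z^2|$. Put $$\Psi_{\underline\lambda,\ell}=\frac1{\lambda_\ell}\bigl(x^{-v_\ell}y^{-w_\ell}\Phi_{\underline\lambda}+\lambda_\ell\bigr),$$ and let $[\,\cdot\,]_{\underline0}$ denote the constant term of a Laurent polynomial. Then there is $\varepsilon_0>0$, depending only on $\Delta$ and $m$, such that the following holds for all $0<\varepsilon<\varepsilon_0$ and all $\underline\lambda$ with $|\lambda_\ell|>c\,\varepsilon^{-2}$ and $|\lambda_j|<\frac1{c\,\varepsilon^3}$ for $j\ne\ell$ (in particular whenever moreover $\mathbf i\lambda_\ell$ lies in the upper half-plane; no condition on $\arg\lambda_\ell$ is needed). The intersection $C^*_{\underline\lambda}\cap\{|X|=\varepsilon\ge|Y|\}$ is a simple closed $C^1$ curve on which $X$ runs once around the circle $|X|=\varepsilon$ and $|Y|<\varepsilon$. Let $\alpha_m$ (the vanishing cycle) be this curve, oriented so that $X$ runs clockwise; equivalently, so that its tube, with the circle around the curve as first factor, is the torus $|X|=|Y|=\varepsilon$ oriented by $d\arg X\wedge d\arg Y$. Then $\sum_{k\ge1}\frac1k[\Psi_{\underline\lambda,\ell}^k]_{\underline0}$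 converges absolutely, and the regulator of the symbol $\{-x,-y\}$ has the value $$\mathscr R_{\underline\lambda}(\alpha_m)=2\pi\mathbf i\Bigl(-\log(-\lambda_\ell)+\sum_{k\ge1}\tfrac1k[\Psi_{\underline\lambda,\ell}^k]_{\underline0}\Bigr)\quad\text{in }\mathbb C/\mathbb Z(2),\qquad \mathbb Z(2)=(2\pi\mathbf i)^2\mathbb Z.$$ Here $\mathscr R_{\underline\lambda}(\alpha)\in\mathbb C/\mathbb Z(2)$ is the class of $$\int_\alpha R\{-x,-y\}=\int_\alpha\log(-x)\frac{dy}y-2\pi\mathbf i\sum_{q\in\alpha\cap T_{-x}}\pm\log(-y(q)),$$ where $\log(-x)$ and $\log(-y)$ are branches of the logarithm with cuts along rays at arbitrary angles, $T_{-x}$ is the preimage of the cut of $\log(-x)$, assumed to be met transversally by $\alpha$ (which holds for arbitrarily small perturbations of the angle $\pi$ of the negative real axis), and the sign is $+$ where $-x$ crosses the cut counterclockwise. -/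

import Mathlib

/-! ## Lattice polygons -/

/-- The determinant of two vectors of `ℤ²`. -/
def latticeDet (u v : ℤ × ℤ) : ℤ := u.1 * v.2 - u.2 * v.1

/-- A convex polygon in `ℝ²` with integer vertices, given by the cyclic list of its `n + 3`
vertices in counterclockwise order (indices are taken modulo `n + 3`): every vertex that is not
an end of the side from `vertex i` to `vertex (i + 1)` lies strictly to the left of this side. -/
structure LatticePolygon (n : ℕ) where
  vertex : Fin (n + 3) → ℤ × ℤ
  convex : ∀ i j, j ≠ i → j ≠ i + 1 →
    0 < latticeDet (vertex (i + 1) - vertex i) (vertex j - vertex i)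

namespace LatticePolygon

variable {n : ℕ} (P : LatticePolygon n)

/-- The side from `vertex i` to `vertex (i + 1)`, as a vector. -/
def side (i : Fin (n + 3)) : ℤ × ℤ := P.vertex (i + 1) - P.vertex i

/-- The lattice length of a side. -/
def sideLength (i : Fin (n + 3)) : ℕ := Int.gcd (P.side i).1 (P.side i).2

/-- The primitive vector in the direction of a side. -/
def sideDir (i : Fin (n + 3)) : ℤ × ℤ :=
  ((P.side i).1 / (P.sideLength i : ℤ), (P.side i).2 / (P.sideLength i : ℤ))

/-- The lattice points of the smallest box that contains the polygon. -/
noncomputable def box : Finset (ℤ × ℤ) :=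
  Finset.Icc (Finset.univ.inf' Finset.univ_nonempty P.vertex)
    (Finset.univ.sup' Finset.univ_nonempty P.vertex)

/-- The lattice points of the (closed) polygon: those that are on no side's right. -/
noncomputable def latticePoints : Finset (ℤ × ℤ) :=
  P.box.filter fun q => ∀ i, 0 ≤ latticeDet (P.side i) (q - P.vertex i)

/-- The lattice points in the interior of the polygon: those strictly to the left of each side. -/
noncomputable def interiorPoints : Finset (ℤ × ℤ) :=
  P.box.filter fun q => ∀ i, 0 < latticeDet (P.side i) (q - P.vertex i)

/-- Toric coordinates adapted to the vertex `p = vertex m`, i.e. an oriented basis `u, v` of `ℤ²`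
such that, in the coordinates `(s, t)` with `q = p + s u + t v`, the vertex is the origin, the
side that leaves it is on the positive `s`-axis, the polygon is in the closed first quadrant, and
`(1, 1)` is an interior point of the polygon. (There is exactly one such basis if the polygon has
an interior lattice point.) -/
structure CornerFrame (m : Fin (n + 3)) where
  u : ℤ × ℤ
  v : ℤ × ℤ
  det_eq_one : latticeDet u v = 1
  u_eq : u = P.sideDir m
  nonneg : ∀ i, 0 ≤ latticeDet (P.vertex i - P.vertex m) v
  node_mem : P.vertex m + u + v ∈ P.interiorPoints

variable {P} in
/-- The interior lattice point with coordinates `(1, 1)`. -/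
noncomputable def CornerFrame.node {m : Fin (n + 3)} (F : P.CornerFrame m) : P.interiorPoints :=
  ⟨P.vertex m + F.u + F.v, F.node_mem⟩

end LatticePolygon

/-! ## The family of curves -/

/-- Laurent polynomials in two variables `x, y` over `ℂ`. -/
abbrev Laurent₂ : Type := AddMonoidAlgebra ℂ (ℤ × ℤ)

/-- The monomial `c x ^ p.1 y ^ p.2`. -/
noncomputable def laurentMonomial (p : ℤ × ℤ) (c : ℂ) : Laurent₂ := AddMonoidAlgebra.single p c

/-- The value of the monomial `x ^ p.1 y ^ p.2` at a point of `(ℂ \ {0})²`. -/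
noncomputable def monomialAt (p : ℤ × ℤ) (z : ℂ × ℂ) : ℂ := z.1 ^ p.1 * z.2 ^ p.2

/-- The value of a Laurent polynomial at a point of `(ℂ \ {0})²`. -/
noncomputable def laurentEval (f : Laurent₂) (z : ℂ × ℂ) : ℂ :=
  f.coeff.sum fun p c => c * monomialAt p z

/-- The constant term of a Laurent polynomial. -/
noncomputable def constantTerm (f : Laurent₂) : ℂ := f.coeff 0

namespace LatticePolygon

variable {n : ℕ} (P : LatticePolygon n)

/-- The Laurent polynomial `φ` supported on the boundary lattice points whose restriction to the
side `i`, of lattice length `κ`, is `x ^ (vertex i) (1 + τ) ^ κ` with `τ = x ^ (sideDir i)`. Each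
boundary lattice point occurs once in the sum: the end `vertex (i + 1)` of the side `i`, with
coefficient `1`, is counted as the first point of the next side. -/
noncomputable def boundaryPoly : Laurent₂ :=
  ∑ i, ∑ k ∈ Finset.range (P.sideLength i),
    laurentMonomial (P.vertex i + k • P.sideDir i) ((P.sideLength i).choose k)

/-- `Φ = φ - ∑ λ_j x ^ v_j y ^ w_j`, the sum being over the interior lattice points. -/
noncomputable def familyPoly (lam : P.interiorPoints → ℂ) : Laurent₂ :=
  P.boundaryPoly - ∑ j : P.interiorPoints, laurentMonomial (j : ℤ × ℤ) (lam j)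

/-- The affine curve `Φ = 0` in `(ℂ \ {0})²`. -/
def curve (lam : P.interiorPoints → ℂ) : Set (ℂ × ℂ) :=
  {z | z.1 ≠ 0 ∧ z.2 ≠ 0 ∧ laurentEval (P.familyPoly lam) z = 0}

/-- `Ψ = λ_ℓ⁻¹ (x ^ (-v_ℓ) y ^ (-w_ℓ) Φ + λ_ℓ)`. -/
noncomputable def psi (lam : P.interiorPoints → ℂ) (l : P.interiorPoints) : Laurent₂ :=
  (lam l)⁻¹ • (laurentMonomial (-(l : ℤ × ℤ)) 1 * P.familyPoly lam + laurentMonomial 0 (lam l))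

variable {P} in
/-- The vanishing cycle: with the adapted toric coordinates `X = x ^ u`, `Y = x ^ v`, the loop
`γ` (on `[0, 1]`, continued with period `1`) runs through the intersection of the curve with
`{|X| = ε ≥ |Y|}`, once, `X` running clockwise. The clockwise orientation is the one whose tube,
oriented with the circle around the curve as first factor, is the torus `|X| = |Y| = ε` with its
orientation by `d arg X ∧ d arg Y`. -/
structure IsVanishingCycle {m : Fin (n + 3)} (F : P.CornerFrame m) (lam : P.interiorPoints → ℂ)
    (ε : ℝ) (γ : ℝ → ℂ × ℂ) : Prop where
  contDiff : ContDiff ℝ 1 γ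
  periodic : Function.Periodic γ 1
  mem_curve : ∀ t, γ t ∈ P.curve lam
  fst_eq : ∀ t, monomialAt F.u (γ t) = ε * Complex.exp (-(2 * Real.pi * t * Complex.I))
  snd_lt : ∀ t, ‖monomialAt F.v (γ t)‖ < ε
  exhausts : ∀ z ∈ P.curve lam, ‖monomialAt F.u z‖ = ε → ‖monomialAt F.v z‖ ≤ ε → ∃ t, γ t = z

end LatticePolygon

/-! ## The regulator current of a symbol -/

/-- The branch of the logarithm with its cut along `{z | z / e ^ (i a) ∈ ℝ_{<0}}`. -/
noncomputable def branchLog (a : ℝ) (z : ℂ) : ℂ :=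
  Complex.log (z * Complex.exp (-(a * Complex.I))) + a * Complex.I

/-- The cut `{z | z / e ^ (i a) ∈ ℝ_{<0}}`. -/
def branchCut (a : ℝ) : Set ℂ := {z | ∃ r : ℝ, r < 0 ∧ z = r * Complex.exp (a * Complex.I)}

/-- The parameters in one period at which the loop `f` meets the cut. -/
def cutTimes (a : ℝ) (f : ℝ → ℂ) : Set ℝ := {t | t ∈ Set.Ico (0 : ℝ) 1 ∧ f t ∈ branchCut a}

/-- The loop `f` crosses the cut transversally wherever it meets it. -/
def CutTransverse (a : ℝ) (f : ℝ → ℂ) : Prop := ∀ t ∈ cutTimes a f, (logDeriv f t).im ≠ 0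

/-- The integral along a loop of the regulator current
`R{f, g} = log f dg/g - 2πi (log g) δ_{T_f}`, where `log f` has its cut along the ray `T_f` at
angle `a` and `log g` at angle `b`; `f` and `g` are given by their values along the loop. The
loop meets `T_f` with sign `+1` where `f` crosses the cut counterclockwise. -/
noncomputable def regulatorIntegral (a b : ℝ) (f g : ℝ → ℂ) : ℂ :=
  (∫ t in (0 : ℝ)..1, branchLog a (f t) * logDeriv g t)
    - 2 * Real.pi * Complex.I *
      ∑ᶠ t ∈ cutTimes a f, ((SignType.sign (logDeriv f t).im : ℤ) : ℂ) * branchLog b (g t)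

/-- `ℤ(2) = (2πi)² ℤ ⊆ ℂ`. -/
noncomputable def tateZ2 : AddSubgroup ℂ := AddSubgroup.zmultiples ((2 * Real.pi * Complex.I) ^ 2)

/-! In the toric coordinates of the corner, `Φ` is a monomial times `Q(X, Y) - λ X Y`, where `λ` is
the coefficient at the node and `Q(X, 0) = (1 + X) ^ κ`. For small `ε` the hypotheses give, on `|X|
= ε ≥ |Y|`, the bound `|Q| ≤ (5/6) |λ| ε²` and make `Y ↦ Q(X, Y) / (λ X)` a contraction
(`exists_nodeDominated`). So each `X` has exactly one root `Y`, and the curve is a graph over the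
circle.

A Jensen-type formula gives an explicit logarithm of `λ X Y` on the graph. With root `y₀` and `c = λ
X`, the function `1 - Q / (c y)` factors as `(1 - y₀ / y) (1 - w y)` with `|w| < 1`, and the mean of
its logarithm over `|y| = ε` is `log (Q(X, 0) / (c y₀))` (`circleAverage_log_one_sub_quotient`).
Hence `N = κ log (1 + X) - mean` satisfies `exp N = λ X Y`; it is `C¹` and periodic. Since `log (1 +
X)` has mean `0`, expanding `-log (1 - Ψ)` shows that the mean of `N` is `∑ (1/k) [Ψ^k]₀`: constant
terms are torus means (`hasSum_constantTerm`).

For loops `exp f`, `exp g` the regulator is `∫ f dg - 2πi p g(0)` modulo `ℤ(2)`, with `p` the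
winding number of `exp f` (`regulatorIntegral_exp`): the sum over the cut cancels the jumps of the
branch of the logarithm. Here `f` and `g` are integral combinations of `log X`, `log Y` and `πi`. In
the integral `N` appears with the factor `det(u, v) = 1`, the terms in `log ε` and `N(0)` cancel,
and what remains is `2πi (∫ N - log λ)` plus an odd multiple of `2 (πi)²`. That multiple turns `log
λ` into `log (-λ)` (`regulatorIntegral_liftedLoop`). -/

section

open Set Filter Topology
open scoped Interval

/-! ## The regulator integral in terms of lifts of the logarithms -/

/-! ### Integration by parts against the floor of a transversal function. -/

section jump

theorem eventually_nhdsGT_lt_of_deriv_pos {θ : ℝ → ℝ} {d τ : ℝ} (h : HasDerivAt θ d τ)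
    (hd : 0 < d) : ∀ᶠ t in 𝓝[>] τ, θ τ < θ t := by
  have h1 := (hasDerivAt_iff_tendsto_slope.1 h).eventually (eventually_gt_nhds hd)
  have h2 : 𝓝[>] τ ≤ 𝓝[≠] τ := nhdsWithin_mono _ (fun x hx => ne_of_gt hx)
  filter_upwards [h2 h1, self_mem_nhdsWithin] with t ht htτ
  rw [slope_def_field] at ht
  have := (div_pos_iff_of_pos_right (sub_pos.2 (mem_Ioi.1 htτ))).1 ht
  linarith

theorem eventually_nhdsLT_lt_of_deriv_pos {θ : ℝ → ℝ} {d τ : ℝ} (h : HasDerivAt θ d τ)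
    (hd : 0 < d) : ∀ᶠ t in 𝓝[<] τ, θ t < θ τ := by
  have h1 := (hasDerivAt_iff_tendsto_slope.1 h).eventually (eventually_gt_nhds hd)
  have h2 : 𝓝[<] τ ≤ 𝓝[≠] τ := nhdsWithin_mono _ (fun x hx => ne_of_lt hx)
  filter_upwards [h2 h1, self_mem_nhdsWithin] with t ht htτ
  rw [slope_def_field] at ht
  have h3 : t - τ < 0 := sub_neg.2 (mem_Iio.1 htτ)
  by_contra hcon
  have := div_nonpos_of_nonneg_of_nonpos (sub_nonneg.2 (not_lt.1 hcon)) h3.le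
  linarith

/-- The points at which a real function takes an integral value. -/
def integralTimes (θ : ℝ → ℝ) : Set ℝ := {t | ∃ m : ℤ, θ t = m}

open Classical in
/-- The jump of `⌊θ⌋` at `t`, if `θ` has nonzero derivative at the integral times. -/
noncomputable def floorJump (θ : ℝ → ℝ) (t : ℝ) : ℤ :=
  if t ∈ integralTimes θ then (SignType.sign (deriv θ t) : ℤ) else 0

open Classical in
/-- The limit of `⌊θ⌋` from the left, if `θ` has nonzero derivative at the integral times. -/
noncomputable def floorLeft (θ : ℝ → ℝ) (t : ℝ) : ℤ :=
  ⌈θ t⌉ - 1 + if t ∈ integralTimes θ ∧ deriv θ t < 0 then 1 else 0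

theorem not_mem_integralTimes {θ : ℝ → ℝ} {t : ℝ} {m : ℤ} (h : (m : ℝ) < θ t ∧ θ t < m + 1) :
    t ∉ integralTimes θ := by
  rintro ⟨k, hk⟩
  rw [hk] at h
  have h1 : m < k := by exact_mod_cast h.1
  have h2 : k < m + 1 := by exact_mod_cast h.2
  omega

theorem ceil_sub_one_eq {x : ℝ} {m : ℤ} (h : (m : ℝ) < x ∧ x < m + 1) : ⌈x⌉ - 1 = m := by
  have : ⌈x⌉ = m + 1 := by
    rw [Int.ceil_eq_iff]; push_cast; constructor <;> linarith [h.1, h.2]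
  omega

theorem floorLeft_eq {θ : ℝ → ℝ} {t : ℝ} {m : ℤ} (h : (m : ℝ) < θ t ∧ θ t < m + 1) :
    floorLeft θ t = m := by
  simp [floorLeft, not_mem_integralTimes h, ceil_sub_one_eq h]

variable {θ : ℝ → ℝ} {g : ℝ → ℂ}

/-- A nonzero derivative at an integral value forces a genuine crossing, whose direction selects the
unit interval entered; at other points continuity suffices. -/
theorem exists_floor_right (hθ : Differentiable ℝ θ) (τ : ℝ)
    (hτ : τ ∈ integralTimes θ → deriv θ τ ≠ 0) :
    ∀ᶠ t in 𝓝[>] τ, ((floorLeft θ τ + floorJump θ τ : ℤ) : ℝ) < θ t ∧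
      θ t < ((floorLeft θ τ + floorJump θ τ : ℤ) : ℝ) + 1 := by
  have hc : Tendsto θ (𝓝[>] τ) (𝓝 (θ τ)) := (hθ.continuous.tendsto τ).mono_left nhdsWithin_le_nhds
  by_cases hx : τ ∈ integralTimes θ
  · obtain ⟨m, hm⟩ := id hx
    rcases lt_or_gt_of_ne (hτ hx) with hd | hd
    · have h1 : floorLeft θ τ + floorJump θ τ = m - 1 := by
        simp [floorLeft, floorJump, hx, hd, hm, ← sub_eq_add_neg]
      rw [h1]
      have h2 := eventually_nhdsGT_lt_of_deriv_pos (hθ τ).hasDerivAt.neg (neg_pos.2 hd)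
      filter_upwards [h2, hc.eventually (eventually_gt_nhds (show θ τ - 1 < θ τ by linarith))]
        with t h3 h4
      simp only [Pi.neg_apply, neg_lt_neg_iff] at h3
      push_cast
      constructor <;> linarith
    · have h1 : floorLeft θ τ + floorJump θ τ = m := by
        simp [floorLeft, floorJump, hx, hd, hm, not_lt.2 hd.le]
      rw [h1]
      have h2 := eventually_nhdsGT_lt_of_deriv_pos (hθ τ).hasDerivAt hd
      filter_upwards [h2, hc.eventually (eventually_lt_nhds (show θ τ < θ τ + 1 by linarith))]
        with t h3 h4
      constructor <;> linarith
  · have h1 : floorLeft θ τ + floorJump θ τ = ⌈θ τ⌉ - 1 := by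
      simp [floorLeft, floorJump, hx]
    rw [h1]
    have h2 : θ τ < ⌈θ τ⌉ := lt_of_le_of_ne (Int.le_ceil _) (fun h => hx ⟨_, h⟩)
    have h3 := Int.ceil_lt_add_one (θ τ)
    push_cast
    filter_upwards [hc.eventually (eventually_lt_nhds h2),
      hc.eventually (eventually_gt_nhds (show (⌈θ τ⌉ : ℝ) - 1 < θ τ by linarith))] with t h4 h5
    constructor <;> linarith

theorem exists_floor_left (hθ : Differentiable ℝ θ) (τ : ℝ)
    (hτ : τ ∈ integralTimes θ → deriv θ τ ≠ 0) :
    ∀ᶠ t in 𝓝[<] τ, (floorLeft θ τ : ℝ) < θ t ∧ θ t < (floorLeft θ τ : ℝ) + 1 := by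
  have hc : Tendsto θ (𝓝[<] τ) (𝓝 (θ τ)) := (hθ.continuous.tendsto τ).mono_left nhdsWithin_le_nhds
  by_cases hx : τ ∈ integralTimes θ
  · obtain ⟨m, hm⟩ := id hx
    rcases lt_or_gt_of_ne (hτ hx) with hd | hd
    · have h1 : floorLeft θ τ = m := by
        simp [floorLeft, hx, hd, hm]
      rw [h1]
      have h2 := eventually_nhdsLT_lt_of_deriv_pos (hθ τ).hasDerivAt.neg (neg_pos.2 hd)
      filter_upwards [h2, hc.eventually (eventually_lt_nhds (show θ τ < θ τ + 1 by linarith))]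
        with t h3 h4
      simp only [Pi.neg_apply, neg_lt_neg_iff] at h3
      constructor <;> linarith
    · have h1 : floorLeft θ τ = m - 1 := by
        simp [floorLeft, hm, hd.le]
      rw [h1]
      have h2 := eventually_nhdsLT_lt_of_deriv_pos (hθ τ).hasDerivAt hd
      filter_upwards [h2, hc.eventually (eventually_gt_nhds (show θ τ - 1 < θ τ by linarith))]
        with t h3 h4
      push_cast
      constructor <;> linarith
  · have h1 : floorLeft θ τ = ⌈θ τ⌉ - 1 := by
      simp [floorLeft, hx]
    rw [h1]
    have h2 : θ τ < ⌈θ τ⌉ := lt_of_le_of_ne (Int.le_ceil _) (fun h => hx ⟨_, h⟩)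
    have h3 := Int.ceil_lt_add_one (θ τ)
    push_cast
    filter_upwards [hc.eventually (eventually_lt_nhds h2),
      hc.eventually (eventually_gt_nhds (show (⌈θ τ⌉ : ℝ) - 1 < θ τ by linarith))] with t h4 h5
    constructor <;> linarith

/-- Integration by parts for `∫ ⌊θ⌋ dg` over `[s, t)`, with the finiteness and integrability that
give it a meaning. -/
structure FloorByParts (θ : ℝ → ℝ) (g : ℝ → ℂ) (s t : ℝ) : Prop where
  le : s ≤ t
  finite : (Ico s t ∩ integralTimes θ).Finite
  integrable : IntervalIntegrable (fun x => ((⌈θ x⌉ - 1 : ℤ) : ℂ) * deriv g x)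
    MeasureTheory.volume s t
  integral_eq : ∫ x in s..t, ((⌈θ x⌉ - 1 : ℤ) : ℂ) * deriv g x =
    floorLeft θ t * g t - floorLeft θ s * g s
      - ∑ᶠ x ∈ Ico s t ∩ integralTimes θ, (floorJump θ x : ℂ) * g x

theorem FloorByParts.trans {s t r : ℝ} (h₁ : FloorByParts θ g s t) (h₂ : FloorByParts θ g t r) :
    FloorByParts θ g s r := by
  have hu : Ico s r ∩ integralTimes θ = Ico s t ∩ integralTimes θ ∪ Ico t r ∩ integralTimes θ := by
    rw [← union_inter_distrib_right, Ico_union_Ico_eq_Ico h₁.le h₂.le]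
  refine ⟨h₁.le.trans h₂.le, hu ▸ h₁.finite.union h₂.finite, h₁.integrable.trans h₂.integrable, ?_⟩
  rw [← intervalIntegral.integral_add_adjacent_intervals h₁.integrable h₂.integrable,
    h₁.integral_eq, h₂.integral_eq, hu, finsum_mem_union _ h₁.finite h₂.finite]
  · ring
  · exact (Ico_disjoint_Ico_same).mono inter_subset_left inter_subset_left

/-- The integrand is `m dg`, and the only possible jump in `[s, t)` is at `s`. The half-open
interval assigns a jump at a common end to the right-hand piece, so that pieces add up. -/
theorem FloorByParts.of_constant (hg : ContDiff ℝ 1 g) {s t : ℝ} (hst : s ≤ t) {m : ℤ}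
    (hm : ∀ x ∈ Ioo s t, (m : ℝ) < θ x ∧ θ x < m + 1)
    (hs : floorLeft θ s + floorJump θ s = m) (ht : floorLeft θ t = m) (hlt : s < t) :
    FloorByParts θ g s t := by
  have hsub : Ico s t ∩ integralTimes θ ⊆ {s} := by
    rintro x ⟨hx, hxθ⟩
    by_contra hne
    exact not_mem_integralTimes (hm x ⟨lt_of_le_of_ne hx.1 (Ne.symm hne), hx.2⟩) hxθ
  -- Only almost everywhere, because `θ t` itself may be an integer.
  have hae : ∀ᵐ x : ℝ, x ∈ Ι s t → (m : ℂ) * deriv g x = ((⌈θ x⌉ - 1 : ℤ) : ℂ) * deriv g x := by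
    filter_upwards [MeasureTheory.Measure.ae_ne MeasureTheory.volume t] with x hxt hx
    rw [uIoc_of_le hst] at hx
    rw [ceil_sub_one_eq (hm x ⟨hx.1, lt_of_le_of_ne hx.2 hxt⟩)]
  have hg' : Continuous (deriv g) := hg.continuous_deriv le_rfl
  have hint : IntervalIntegrable (fun x => (m : ℂ) * deriv g x) MeasureTheory.volume s t :=
    (continuous_const.mul hg').intervalIntegrable _ _
  refine ⟨hst, (finite_singleton s).subset hsub, ?_, ?_⟩
  · refine hint.congr_ae ?_
    rwa [Filter.EventuallyEq, MeasureTheory.ae_restrict_iff' measurableSet_uIoc]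
  · rw [← intervalIntegral.integral_congr_ae hae, intervalIntegral.integral_const_mul,
      intervalIntegral.integral_deriv_eq_sub (fun x _ => (hg.differentiable one_ne_zero) x)
        (hg'.intervalIntegrable _ _), ht]
    have hsum : ∑ᶠ x ∈ Ico s t ∩ integralTimes θ, (floorJump θ x : ℂ) * g x
        = floorJump θ s * g s := by
      by_cases hx : s ∈ integralTimes θ
      · have : Ico s t ∩ integralTimes θ = {s} :=
          hsub.antisymm (by rintro x rfl; exact ⟨left_mem_Ico.2 hlt, hx⟩)
        rw [this, finsum_mem_singleton]
      · have : Ico s t ∩ integralTimes θ = ∅ := by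
          rw [eq_empty_iff_forall_notMem]
          rintro x hx'
          have := hsub hx'
          rw [mem_singleton_iff] at this
          exact hx (this ▸ hx'.2)
        rw [this, finsum_mem_empty]
        simp [floorJump, hx]
    rw [hsum, ← hs]
    push_cast
    ring

theorem floorJump_eq_zero {t : ℝ} {m : ℤ} (h : (m : ℝ) < θ t ∧ θ t < m + 1) :
    floorJump θ t = 0 := by
  simp [floorJump, not_mem_integralTimes h]

theorem FloorByParts.eventually_right (hg : ContDiff ℝ 1 g) (hθ : Differentiable ℝ θ) (τ : ℝ)
    (hτ : τ ∈ integralTimes θ → deriv θ τ ≠ 0) : ∀ᶠ t in 𝓝[>] τ, FloorByParts θ g τ t := by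
  obtain ⟨u, hu, hsub⟩ := (mem_nhdsGT_iff_exists_Ioo_subset).1 (exists_floor_right hθ τ hτ)
  filter_upwards [Ioo_mem_nhdsGT hu] with t ht
  exact .of_constant hg ht.1.le (fun x hx => hsub ⟨hx.1, hx.2.trans ht.2⟩) rfl
    (floorLeft_eq (hsub ht)) ht.1

theorem FloorByParts.eventually_left (hg : ContDiff ℝ 1 g) (hθ : Differentiable ℝ θ) (τ : ℝ)
    (hτ : τ ∈ integralTimes θ → deriv θ τ ≠ 0) : ∀ᶠ t in 𝓝[<] τ, FloorByParts θ g t τ := by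
  obtain ⟨u, hu, hsub⟩ := (mem_nhdsLT_iff_exists_Ioo_subset).1 (exists_floor_left hθ τ hτ)
  filter_upwards [Ioo_mem_nhdsLT hu] with t ht
  refine .of_constant hg ht.2.le (fun x hx => hsub ⟨ht.1.trans hx.1, hx.2⟩) ?_ rfl ht.2
  rw [floorLeft_eq (hsub ht), floorJump_eq_zero (hsub ht), add_zero]

theorem FloorByParts.refl (t : ℝ) : FloorByParts θ g t t :=
  ⟨le_rfl, by simp, by simp, by simp⟩

/-- A transitive relation on `ℝ` that holds near each point on either side holds on an interval. -/
theorem rel_of_locally {R : ℝ → ℝ → Prop} {a b : ℝ} (hab : a ≤ b) (refl : ∀ t, R t t)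
    (trans : ∀ {r s t}, R r s → R s t → R r t)
    (right : ∀ τ ∈ Icc a b, ∀ᶠ t in 𝓝[>] τ, R τ t)
    (left : ∀ τ ∈ Icc a b, ∀ᶠ t in 𝓝[<] τ, R t τ) : R a b := by
  -- Continuous induction: the supremum of the points reached from `a` is itself reached, by the
  -- left condition, and cannot be smaller than `b`, by the right one.
  set S : Set ℝ := {t | t ∈ Icc a b ∧ R a t} with hS
  have haS : a ∈ S := ⟨left_mem_Icc.2 hab, refl a⟩
  have hbdd : BddAbove S := ⟨b, fun t ht => ht.1.2⟩
  set τ := sSup S with hτ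
  have hτI : τ ∈ Icc a b := ⟨le_csSup hbdd haS, csSup_le ⟨a, haS⟩ fun t ht => ht.1.2⟩
  have hτS : R a τ := by
    obtain ⟨u, hu, hsub⟩ := (mem_nhdsLT_iff_exists_Ioo_subset).1 (left τ hτI)
    obtain ⟨s, hs, hus⟩ := exists_lt_of_lt_csSup ⟨a, haS⟩ (show u < sSup S from hu)
    rcases (le_csSup hbdd hs).eq_or_lt with h | h
    · exact (show s = τ from h) ▸ hs.2
    · exact trans hs.2 (hsub ⟨hus, h⟩)
  rcases hτI.2.eq_or_lt with h | h
  · exact h ▸ hτS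
  · obtain ⟨t, ht, ht'⟩ := ((right τ hτI).and (Ioo_mem_nhdsGT h)).exists
    exact absurd (le_csSup hbdd (show t ∈ S from
      ⟨⟨hτI.1.trans ht'.1.le, ht'.2.le⟩, trans hτS ht⟩)) (not_le.2 ht'.1)

theorem floorByParts (hg : ContDiff ℝ 1 g) (hθ : Differentiable ℝ θ) {a b : ℝ} (hab : a ≤ b)
    (h : ∀ τ ∈ Icc a b, τ ∈ integralTimes θ → deriv θ τ ≠ 0) : FloorByParts θ g a b :=
  rel_of_locally hab FloorByParts.refl FloorByParts.trans
    (fun τ hτ => FloorByParts.eventually_right hg hθ τ (h τ hτ))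
    (fun τ hτ => FloorByParts.eventually_left hg hθ τ (h τ hτ))

theorem integralTimes_add {t r : ℝ} {p : ℤ} (h : θ r = θ t + p) :
    r ∈ integralTimes θ ↔ t ∈ integralTimes θ := by
  constructor
  · rintro ⟨m, hm⟩; exact ⟨m - p, by push_cast; linarith⟩
  · rintro ⟨m, hm⟩; exact ⟨m + p, by push_cast; linarith⟩

theorem floorLeft_add {t r : ℝ} {p : ℤ} (h : θ r = θ t + p) (hd : deriv θ r = deriv θ t) :
    floorLeft θ r = floorLeft θ t + p := by
  classical
  have hi : (r ∈ integralTimes θ ∧ deriv θ r < 0) ↔ (t ∈ integralTimes θ ∧ deriv θ t < 0) := by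
    rw [integralTimes_add h, hd]
  have hc : ⌈θ r⌉ = ⌈θ t⌉ + p := by rw [h, Int.ceil_add_intCast]
  simp only [floorLeft, hc, if_congr hi rfl rfl]
  ring

end jump

/-! ### The regulator of a pair of exponentials. -/

section lift

open Complex

variable {f g : ℝ → ℂ}

/-- The argument of `e ^ f`, in turns, counted from the cut at angle `a`. -/
noncomputable def cutPhase (a : ℝ) (f : ℝ → ℂ) (t : ℝ) : ℝ :=
  ((f t).im - a) / (2 * Real.pi) + 1 / 2

/-- The number of full turns to remove is `⌈·⌉ - 1` and not `⌊·⌋`, because the principal argument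
takes the value `π`, not `-π`, on the cut. -/
theorem branchLog_exp (a : ℝ) (w : ℂ) :
    branchLog a (exp w) =
      w - 2 * Real.pi * I * ((⌈(w.im - a) / (2 * Real.pi) + 1 / 2⌉ - 1 : ℤ) : ℂ) := by
  set n : ℤ := ⌈(w.im - a) / (2 * Real.pi) + 1 / 2⌉ - 1 with hn
  have hπ : 0 < 2 * Real.pi := Real.two_pi_pos
  have h1 : (n : ℝ) < (w.im - a) / (2 * Real.pi) + 1 / 2 := by
    rw [hn]; push_cast; linarith [Int.ceil_lt_add_one ((w.im - a) / (2 * Real.pi) + 1 / 2)]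
  have h2 : (w.im - a) / (2 * Real.pi) + 1 / 2 ≤ n + 1 := by
    rw [hn]; push_cast; linarith [Int.le_ceil ((w.im - a) / (2 * Real.pi) + 1 / 2)]
  have h3 : (w.im - a) / (2 * Real.pi) * (2 * Real.pi) = w.im - a := div_mul_cancel₀ _ hπ.ne'
  have he : exp w * exp (-(a * I)) = exp (w - a * I - n * (2 * Real.pi * I)) := by
    rw [← exp_add, exp_sub (w - a * I), exp_int_mul_two_pi_mul_I, div_one, sub_eq_add_neg]
  have him : (w - a * I - n * (2 * Real.pi * I)).im = w.im - a - n * (2 * Real.pi) := by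
    simp
  rw [branchLog, he, log_exp]
  · ring
  · rw [him]; nlinarith
  · rw [him]; nlinarith

theorem exp_mem_branchCut {a : ℝ} {w : ℂ} :
    exp w ∈ branchCut a ↔ ∃ m : ℤ, (w.im - a) / (2 * Real.pi) + 1 / 2 = m := by
  have hπ := Real.pi_ne_zero
  constructor
  · rintro ⟨r, hr, h⟩
    have h1 : exp w = exp (Real.log (-r) + (a + Real.pi) * I) := by
      rw [h, exp_add, add_mul, exp_add, exp_pi_mul_I, ← ofReal_exp, Real.exp_log (neg_pos.2 hr)]
      push_cast; ring
    obtain ⟨n, hn⟩ := exp_eq_exp_iff_exists_int.1 h1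
    refine ⟨n + 1, ?_⟩
    have := congrArg im hn
    simp at this
    rw [this]; push_cast; field_simp; ring
  · rintro ⟨m, hm⟩
    refine ⟨-Real.exp w.re, neg_neg_of_pos (Real.exp_pos _), ?_⟩
    have him : w.im = a - Real.pi + m * (2 * Real.pi) := by
      field_simp at hm; linarith
    have hw : w = w.re + (a * I - Real.pi * I + m * (2 * Real.pi * I)) := by
      apply Complex.ext <;> simp [him]
    rw [hw, exp_add, exp_add, exp_int_mul_two_pi_mul_I, exp_sub, exp_pi_mul_I]
    simp [div_neg]

theorem logDeriv_exp_comp {t : ℝ} (hf : DifferentiableAt ℝ f t) :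
    logDeriv (fun t => exp (f t)) t = deriv f t := by
  rw [logDeriv_apply, (hf.hasDerivAt.cexp).deriv, mul_div_assoc, mul_comm,
    div_mul_cancel₀ _ (exp_ne_zero _)]

theorem hasDerivAt_cutPhase (a : ℝ) {t : ℝ} (hf : DifferentiableAt ℝ f t) :
    HasDerivAt (cutPhase a f) ((deriv f t).im / (2 * Real.pi)) t := by
  have h1 : HasDerivAt (fun t => (f t).im) (deriv f t).im t :=
    (imCLM.hasFDerivAt.comp_hasDerivAt t hf.hasDerivAt)
  exact ((h1.sub_const a).div_const _).add_const _

theorem mem_cutTimes_exp {a t : ℝ} :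
    t ∈ cutTimes a (fun t => exp (f t)) ↔ t ∈ Ico (0 : ℝ) 1 ∩ integralTimes (cutPhase a f) := by
  simp only [cutTimes, integralTimes, mem_inter_iff, mem_ofPred_eq, exp_mem_branchCut, cutPhase]

theorem sign_deriv_cutPhase (a : ℝ) {t : ℝ} (hf : DifferentiableAt ℝ f t) :
    SignType.sign (deriv (cutPhase a f) t) = SignType.sign (deriv f t).im := by
  rw [(hasDerivAt_cutPhase a hf).deriv]
  rcases lt_trichotomy (deriv f t).im 0 with h | h | h
  · rw [sign_neg h, sign_neg (div_neg_of_neg_of_pos h Real.two_pi_pos)]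
  · simp [h]
  · rw [sign_pos h, sign_pos (div_pos h Real.two_pi_pos)]

theorem deriv_eq_of_add_period {c : ℂ} (hf : ∀ t, f (t + 1) = f t + c) (t : ℝ) :
    deriv f (t + 1) = deriv f t := by
  have : (fun t => f (t + 1)) = fun t => f t + c := funext hf
  rw [← deriv_comp_add_const, this, deriv_add_const]

/-- The regulator integral of a pair of loops with logarithms `f`, `g`. -/
theorem regulatorIntegral_exp (hf : ContDiff ℝ 1 f) (hg : ContDiff ℝ 1 g) {p q : ℤ}
    (hfp : ∀ t, f (t + 1) = f t + 2 * Real.pi * I * p)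
    (hgq : ∀ t, g (t + 1) = g t + 2 * Real.pi * I * q) (a b : ℝ)
    (ha : CutTransverse a (fun t => exp (f t))) :
    ∃ k : ℤ, regulatorIntegral a b (fun t => exp (f t)) (fun t => exp (g t)) =
      (∫ t in (0 : ℝ)..1, f t * deriv g t) - 2 * Real.pi * I * (p * g 0)
        + k * (2 * Real.pi * I) ^ 2 := by
  have hfd : Differentiable ℝ f := hf.differentiable one_ne_zero
  have hgd : Differentiable ℝ g := hg.differentiable one_ne_zero
  set θ := cutPhase a f with hθdef
  have hθ : Differentiable ℝ θ := fun t => (hasDerivAt_cutPhase a (hfd t)).differentiableAt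
  have hθ1 : θ 1 = θ 0 + p := by
    have h := hfp 0
    rw [zero_add] at h
    simp only [hθdef, cutPhase, h]
    have : (2 * Real.pi * I * (p : ℂ)).im = 2 * Real.pi * p := by simp
    rw [add_im, this]
    field_simp
    ring
  have hdf1 : deriv f 1 = deriv f 0 := by simpa using deriv_eq_of_add_period hfp 0
  have hdθ1 : deriv θ 1 = deriv θ 0 := by
    rw [(hasDerivAt_cutPhase a (hfd 1)).deriv, (hasDerivAt_cutPhase a (hfd 0)).deriv, hdf1]
  have htr0 : ∀ t ∈ Ico (0 : ℝ) 1, t ∈ integralTimes θ → deriv θ t ≠ 0 := by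
    intro t ht hti
    have := ha t (mem_cutTimes_exp.2 ⟨ht, hti⟩)
    rw [logDeriv_exp_comp (hfd t)] at this
    rw [(hasDerivAt_cutPhase a (hfd t)).deriv]
    exact div_ne_zero this Real.two_pi_pos.ne'
  -- `CutTransverse` only speaks of `[0, 1)`; at `1` the phase differs from that at `0` by an
  -- integer and the derivatives agree.
  have htr : ∀ t ∈ Icc (0 : ℝ) 1, t ∈ integralTimes θ → deriv θ t ≠ 0 := by
    intro t ht hti
    rcases ht.2.eq_or_lt with rfl | h
    · rw [hdθ1]
      exact htr0 0 (by simp) ((integralTimes_add hθ1).1 hti)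
    · exact htr0 t ⟨ht.1, h⟩ hti
  have key := floorByParts hg hθ zero_le_one htr
  have hset : cutTimes a (fun t => exp (f t)) = Ico (0 : ℝ) 1 ∩ integralTimes θ :=
    Set.ext fun t => mem_cutTimes_exp
  have hfin := key.finite
  have hint : ∫ t in (0 : ℝ)..1, branchLog a (exp (f t)) * logDeriv (fun t => exp (g t)) t =
      (∫ t in (0 : ℝ)..1, f t * deriv g t) -
        2 * Real.pi * I * ∫ t in (0 : ℝ)..1, ((⌈θ t⌉ - 1 : ℤ) : ℂ) * deriv g t := by
    rw [← intervalIntegral.integral_const_mul, ← intervalIntegral.integral_sub]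
    · refine intervalIntegral.integral_congr fun t _ => ?_
      simp only [branchLog_exp, logDeriv_exp_comp (hgd t), hθdef, cutPhase]
      ring
    · exact (hf.continuous.mul (hg.continuous_deriv le_rfl)).intervalIntegrable _ _
    · exact key.integrable.const_mul _
  set φ := cutPhase b g with hφ
  have hsum : ∑ᶠ t ∈ cutTimes a (fun t => exp (f t)),
      ((SignType.sign (logDeriv (fun t => exp (f t)) t).im : ℤ) : ℂ) * branchLog b (exp (g t)) =
      (∑ᶠ t ∈ Ico (0 : ℝ) 1 ∩ integralTimes θ, (floorJump θ t : ℂ) * g t) -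
        2 * Real.pi * I * ((∑ t ∈ hfin.toFinset, floorJump θ t * (⌈φ t⌉ - 1) : ℤ) : ℂ) := by
    rw [hset, finsum_mem_eq_finite_toFinset_sum _ hfin, finsum_mem_eq_finite_toFinset_sum _ hfin]
    push_cast
    rw [Finset.mul_sum, ← Finset.sum_sub_distrib]
    refine Finset.sum_congr rfl fun t ht => ?_
    have hti := ((Set.Finite.mem_toFinset hfin).1 ht).2
    have hj : floorJump θ t = SignType.sign (deriv f t).im := by
      rw [floorJump, if_pos hti, sign_deriv_cutPhase a (hfd t)]
    rw [branchLog_exp, logDeriv_exp_comp (hfd t), hj]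
    simp only [hφ, cutPhase]
    push_cast
    ring
  have hlo : floorLeft θ 1 = floorLeft θ 0 + p := floorLeft_add hθ1 hdθ1
  have hg1 : g 1 = g 0 + 2 * Real.pi * I * q := by simpa using hgq 0
  -- The jump terms with the lift `g` cancel. The sum comes from the difference between `g` and the
  -- branch of its logarithm at the crossings, the product from the increment `2πi q` of `g` in the
  -- boundary term.
  refine ⟨(∑ t ∈ hfin.toFinset, floorJump θ t * (⌈φ t⌉ - 1)) - (floorLeft θ 0 + p) * q, ?_⟩
  rw [regulatorIntegral, hint, hsum, key.integral_eq, hlo, hg1]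
  push_cast
  ring

/-- The transversality holds for almost all angles of the cut. -/
theorem exists_cutTransverse_exp (hf : ContDiff ℝ 1 f) {δ : ℝ} (hδ : 0 < δ) :
    ∃ a ∈ Ioo 0 δ, CutTransverse a (fun t => exp (f t)) := by
  have hfd : Differentiable ℝ f := hf.differentiable one_ne_zero
  have him : ∀ t, HasDerivAt (fun t => (f t).im) (deriv f t).im t := fun t =>
    (imCLM.hasFDerivAt.comp_hasDerivAt t (hfd t).hasDerivAt)
  set S : Set ℝ := {t | (deriv f t).im = 0} with hS
  -- Sard's theorem in dimension one. The bad angles are translates of these critical values by odd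
  -- multiples of `π`, so they too form a null set.
  have h0 : MeasureTheory.volume ((fun t => (f t).im) '' S) = 0 := by
    refine MeasureTheory.addHaar_image_eq_zero_of_det_fderivWithin_eq_zero _
      (f' := fun t => ContinuousLinearMap.toSpanSingleton ℝ (deriv f t).im)
      (fun t _ => (him t).hasFDerivAt.hasFDerivWithinAt) fun t ht => ?_
    have : (deriv f t).im = 0 := ht
    rw [this]
    simp
  have h1 : ∀ m : ℤ, MeasureTheory.volume
      ((fun y => y - (2 * Real.pi) * (m - 1 / 2)) '' ((fun t => (f t).im) '' S)) = 0 := by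
    intro m
    simp only [sub_eq_add_neg]
    rw [image_add_right, MeasureTheory.measure_preimage_add_right, h0]
  have h2 := MeasureTheory.measure_iUnion_null h1
  have h3 : ∃ a ∈ Ioo 0 δ,
      a ∉ ⋃ m : ℤ, (fun y => y - (2 * Real.pi) * (m - 1 / 2)) '' ((fun t => (f t).im) '' S) := by
    by_contra! hcon
    have := MeasureTheory.measure_mono_null hcon h2
    simp [hδ.not_ge] at this
  obtain ⟨a, ha, haS⟩ := h3
  refine ⟨a, ha, fun t ht hzero => haS ?_⟩
  rw [logDeriv_exp_comp (hfd t)] at hzero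
  obtain ⟨m, hm⟩ := exp_mem_branchCut.1 ht.2
  refine mem_iUnion.2 ⟨m, _, ⟨t, hzero, rfl⟩, ?_⟩
  have := Real.pi_ne_zero
  field_simp at hm ⊢
  linarith

end lift

end

section

open Set Filter Topology Metric

/-! ## The root in the disc and the logarithm of the family over it -/

section analysis

open Complex Real

theorem contDiff_integral_of_contDiff {G : ℝ × ℝ → ℂ} (hG : ContDiff ℝ 1 G) (a b : ℝ) :
    ContDiff ℝ 1 (fun t => ∫ s in a..b, G (t, s)) := by
  set G' : ℝ → ℝ → ℂ := fun t s => fderiv ℝ G (t, s) (1, 0) with hG'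
  have hc' : Continuous (Function.uncurry G') :=
    (hG.continuous_fderiv one_ne_zero).clm_apply continuous_const
  have hd : ∀ t s, HasDerivAt (fun t => G (t, s)) (G' t s) t := fun t s => by
    have h1 := ((hG.differentiable one_ne_zero) (t, s)).hasFDerivAt
    exact h1.comp_hasDerivAt t ((hasDerivAt_id t).prodMk (hasDerivAt_const t s))
  have hder : ∀ t, HasDerivAt (fun t => ∫ s in a..b, G (t, s)) (∫ s in a..b, G' t s) t := by
    intro t
    obtain ⟨C, hC⟩ := ((isCompact_closedBall t 1).prod (isCompact_uIcc (a := a) (b := b))).bddAbove_image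
      hc'.norm.continuousOn
    refine (intervalIntegral.hasDerivAt_integral_of_dominated_loc_of_deriv_le
      (F := fun t s => G (t, s)) (F' := G') (bound := fun _ => C)
      (closedBall_mem_nhds t one_pos) ?_ ?_ ?_ ?_ ?_ ?_).2
    · exact Eventually.of_forall fun x =>
        (hG.continuous.comp (Continuous.prodMk_right x)).aestronglyMeasurable
    · exact (hG.continuous.comp (Continuous.prodMk_right t)).intervalIntegrable _ _
    · exact (hc'.comp (Continuous.prodMk_right t)).aestronglyMeasurable
    · refine Eventually.of_forall fun s hs x hx => hC ⟨(x, s), ⟨hx, uIoc_subset_uIcc hs⟩, rfl⟩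
    · exact intervalIntegrable_const
    · exact Eventually.of_forall fun s _ x _ => hd x s
  rw [contDiff_one_iff_deriv]
  refine ⟨fun t => (hder t).differentiableAt, ?_⟩
  rw [show deriv (fun t => ∫ s in a..b, G (t, s)) = fun t => ∫ s in a..b, G' t s from
    funext fun t => (hder t).deriv]
  exact intervalIntegral.continuous_parametric_intervalIntegral_of_continuous' hc' a b

theorem one_sub_mem_slitPlane {z : ℂ} (hz : ‖z‖ < 1) : 1 - z ∈ slitPlane :=
  ball_one_subset_slitPlane (by simpa [dist_eq_norm] using hz)

theorem abs_arg_one_sub_lt {z : ℂ} (hz : ‖z‖ < 1) : |arg (1 - z)| < π / 2 := by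
  rw [abs_arg_lt_pi_div_two_iff]
  left
  have := (abs_le.1 (abs_re_le_norm z)).2
  simp only [sub_re, one_re]
  linarith

/-- Both factors lie in the right half-plane, so their arguments add without leaving `(-π, π)`. -/
theorem log_one_sub_mul_one_sub {z w : ℂ} (hz : ‖z‖ < 1) (hw : ‖w‖ < 1) :
    log ((1 - z) * (1 - w)) = log (1 - z) + log (1 - w) := by
  have h1 := abs_lt.1 (abs_arg_one_sub_lt hz)
  have h2 := abs_lt.1 (abs_arg_one_sub_lt hw)
  refine log_mul (slitPlane_ne_zero (one_sub_mem_slitPlane hz))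
    (slitPlane_ne_zero (one_sub_mem_slitPlane hw)) ⟨?_, ?_⟩ <;> linarith [h1.1, h1.2, h2.1, h2.2]

/-- The mean of `log (1 - a z)` over a circle around `0` on which `‖a z‖ < 1`. -/
theorem circleAverage_log_one_sub_mul {a : ℂ} {r : ℝ} (h : ‖a‖ * |r| < 1) :
    circleAverage (fun z => log (1 - a * z)) 0 r = 0 := by
  have hlt : ∀ z ∈ closedBall (0 : ℂ) |r|, ‖a * z‖ < 1 := fun z hz => by
    rw [norm_mul]
    exact (mul_le_mul_of_nonneg_left (mem_closedBall_zero_iff.1 hz) (norm_nonneg a)).trans_lt h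
  have hd : DifferentiableOn ℂ (fun z => log (1 - a * z)) (closedBall 0 |r|) := fun z hz =>
    (((differentiableAt_const _).sub ((differentiableAt_const a).mul differentiableAt_id)).clog
      (one_sub_mem_slitPlane (hlt z hz))).differentiableWithinAt
  rw [circleAverage_of_differentiable_on_off_countable countable_empty hd.continuousOn]
  · simp
  · intro z hz
    exact ((differentiableAt_const _).sub ((differentiableAt_const a).mul differentiableAt_id)).clog
      (one_sub_mem_slitPlane (hlt z (ball_subset_closedBall hz.1)))

/-- Inversion of the unit circle reduces this to `circleAverage_log_one_sub_mul`. -/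
theorem circleAverage_log_one_sub_div {a : ℂ} {r : ℝ} (hr : 0 < r) (h : ‖a‖ < r) :
    circleAverage (fun z => log (1 - a / z)) 0 r = 0 := by
  rw [circleAverage_eq_circleAverage_zero_one]
  have h1 := circleAverage_zero_one_congr_inv (f := fun z => log (1 - a / (r * z)))
  have h2 : (fun z : ℂ => log (1 - a / (r * z))) = fun z => log (1 - a / r * z⁻¹) := by
    funext z; rw [div_mul_eq_div_div, div_eq_mul_inv (a / r)]
  have h3 := circleAverage_log_one_sub_mul (a := a / r) (r := 1)
    (by rw [norm_div, abs_one, mul_one, norm_real, Real.norm_of_nonneg hr.le, div_lt_one hr]; exact h)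
  simp only [add_zero]
  rw [h2, ← circleAverage_zero_one_congr_inv]
  simpa using h3

/-- If `y₀` solves `c y = q y` in the disc of radius `r` and `q` is a contraction relative to
`c`, the mean of `log (1 - q y / (c y))` over the boundary is given by the value of `q` at `0`. -/
theorem circleAverage_log_one_sub_quotient {q : ℂ → ℂ} (hq : Differentiable ℂ q) {c y₀ : ℂ}
    {r K : ℝ} (hr : 0 < r) (hK : K < ‖c‖)
    (hlip : ∀ y y', ‖y‖ ≤ r → ‖y'‖ ≤ r → ‖q y - q y'‖ ≤ K * ‖y - y'‖)
    (hy₀ : ‖y₀‖ < r) (hy₀' : y₀ ≠ 0) (hroot : c * y₀ = q y₀) :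
    circleAverage (fun y => log (1 - q y / (c * y))) 0 r = log (q 0 / (c * y₀)) := by
  have hK0 : 0 ≤ K := by
    have := (norm_nonneg _).trans (hlip y₀ 0 hy₀.le (by simpa using hr.le))
    rw [sub_zero] at this
    exact nonneg_of_mul_nonneg_left this (norm_pos_iff.2 hy₀')
  have hc : c ≠ 0 := norm_pos_iff.1 (hK0.trans_lt hK)
  -- Since `q y₀ = c y₀`, dividing out the root gives `1 - q y / (c y) = (1 - y₀ / y) (1 - w y)`.
  -- The function `w` is entire, and the Lipschitz bound gives `‖w‖ < 1` on the disc.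
  set w : ℂ → ℂ := fun y => dslope q y₀ y / c with hw
  have hball : ball (0 : ℂ) r ∈ 𝓝 y₀ := isOpen_ball.mem_nhds (by simpa using hy₀)
  have hwlt : ∀ y, ‖y‖ ≤ r → ‖w y‖ < 1 := by
    intro y hy
    have h1 : ‖dslope q y₀ y‖ ≤ K := by
      by_cases h : y = y₀
      · rw [h, dslope_same]
        have := norm_deriv_le_of_lipschitzOn (f := q) (C := ⟨K, hK0⟩) hball
          (LipschitzOnWith.of_dist_le_mul fun y hy y' hy' => by
            rw [dist_eq_norm, dist_eq_norm]
            exact hlip y y' (mem_ball_zero_iff.1 hy).le (mem_ball_zero_iff.1 hy').le)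
        exact this
      · rw [dslope_of_ne _ h, slope_def_field, norm_div, div_le_iff₀ (norm_pos_iff.2 (sub_ne_zero.2 h))]
        exact hlip y y₀ hy hy₀.le
    rw [hw, norm_div, div_lt_one (norm_pos_iff.2 hc)]
    exact h1.trans_lt hK
  have hwd : Differentiable ℂ w := by
    have : Differentiable ℂ (dslope q y₀) := by
      rw [← differentiableOn_univ, Complex.differentiableOn_dslope univ_mem, differentiableOn_univ]
      exact hq
    exact this.div_const c
  have hsplit : ∀ y, ‖y‖ = r →
      log (1 - q y / (c * y)) = log (1 - y₀ / y) + log (1 - w y) := by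
    intro y hy
    have hy0 : y ≠ 0 := norm_pos_iff.1 (hy ▸ hr)
    have hne : y - y₀ ≠ 0 := sub_ne_zero.2 (by rintro rfl; exact hy₀.ne hy)
    rw [← log_one_sub_mul_one_sub _ (hwlt y hy.le)]
    · congr 1
      simp only [hw, dslope_of_ne q (sub_ne_zero.1 hne), slope_def_field, ← hroot]
      field_simp
      ring
    · rw [norm_div, hy, div_lt_one hr]; exact hy₀
  have hwint : CircleIntegrable (fun y => log (1 - w y)) 0 r := by
    refine ContinuousOn.circleIntegrable hr.le fun y hy => ?_
    exact ((((differentiableAt_const _).sub (hwd y)).clog (one_sub_mem_slitPlane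
      (hwlt y (mem_sphere_zero_iff_norm.1 hy).le))).continuousAt).continuousWithinAt
  have hyint : CircleIntegrable (fun y => log (1 - y₀ / y)) 0 r := by
    refine ContinuousOn.circleIntegrable hr.le fun y hy => ?_
    have hy' := mem_sphere_zero_iff_norm.1 hy
    have hy0 : y ≠ 0 := norm_pos_iff.1 (hy' ▸ hr)
    refine ((continuousAt_const.sub (continuousAt_const.div continuousAt_id hy0)).clog
      (one_sub_mem_slitPlane ?_)).continuousWithinAt
    change ‖y₀ / y‖ < 1
    rw [norm_div, hy', div_lt_one hr]; exact hy₀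
  -- The first factor contributes `0`. The second is holomorphic in the disc and contributes its
  -- value at the centre, where `1 - w 0 = q 0 / (c y₀)`.
  rw [circleAverage_congr_sphere (f₂ := (fun y => log (1 - y₀ / y)) + fun y => log (1 - w y))
      (fun y hy => hsplit y (by simpa [abs_of_pos hr] using hy)),
    circleAverage_add hyint hwint, circleAverage_log_one_sub_div hr hy₀, zero_add,
    circleAverage_of_differentiable_on_off_countable countable_empty]
  · congr 1
    simp only [hw, dslope_of_ne q hy₀'.symm, slope_def_field, ← hroot]
    field_simp
    ring
  · intro y hy
    rw [abs_of_pos hr] at hy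
    exact (((differentiableAt_const _).sub (hwd y)).clog (one_sub_mem_slitPlane
      (hwlt y (mem_closedBall_zero_iff.1 hy)))).continuousAt.continuousWithinAt
  · intro y hy
    rw [abs_of_pos hr] at hy
    exact ((differentiableAt_const _).sub (hwd y)).clog (one_sub_mem_slitPlane
      (hwlt y (mem_ball_zero_iff.1 hy.1).le))

end analysis

end

section

/-! ## Means over a torus -/

open Set Filter Topology Metric

section torus

open Complex
open scoped Real
open Real (circleAverage circleAverage_def circleAverage_fun_smul circleAverage_const)

/-- The circle of radius `ε`, run through once, clockwise, on `[0, 1]`. -/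
noncomputable def clockwise (ε t : ℝ) : ℂ := ε * exp (-(2 * π * t * I))

theorem norm_clockwise {ε : ℝ} (hε : 0 < ε) (t : ℝ) : ‖clockwise ε t‖ = ε := by
  have : -(2 * π * t * I) = ((-(2 * π * t) : ℝ) : ℂ) * I := by push_cast; ring
  rw [clockwise, this, norm_mul, norm_exp_ofReal_mul_I, mul_one, norm_real,
    Real.norm_of_nonneg hε.le]

theorem clockwise_ne_zero {ε : ℝ} (hε : 0 < ε) (t : ℝ) : clockwise ε t ≠ 0 :=
  norm_pos_iff.1 (by rw [norm_clockwise hε]; exact hε)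

theorem clockwise_periodic (ε t : ℝ) : clockwise ε (t + 1) = clockwise ε t := by
  have : -(2 * π * ((t + 1 : ℝ) : ℂ) * I) = -(2 * π * t * I) - 2 * π * I := by push_cast; ring
  rw [clockwise, clockwise, this, exp_sub, exp_two_pi_mul_I, div_one]

theorem contDiff_clockwise (ε : ℝ) {n : WithTop ℕ∞} : ContDiff ℝ n (clockwise ε) := by
  unfold clockwise
  have : ContDiff ℝ n (fun t : ℝ => (t : ℂ)) := ofRealCLM.contDiff
  fun_prop

theorem contDiff_clog {E : Type*} [NormedAddCommGroup E] [NormedSpace ℝ E] {f : E → ℂ}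
    {n : WithTop ℕ∞} (hf : ContDiff ℝ n f) (h : ∀ x, f x ∈ slitPlane) :
    ContDiff ℝ n fun x => log (f x) :=
  contDiff_iff_contDiffAt.2 fun x =>
    ((contDiffAt_log (h x)).restrict_scalars ℝ).comp x hf.contDiffAt

theorem exists_clockwise_eq {ε : ℝ} {z : ℂ} (hz : ‖z‖ = ε) :
    ∃ t, clockwise ε t = z := by
  refine ⟨-(arg z / (2 * π)), ?_⟩
  have : -(2 * π * ((-(arg z / (2 * π)) : ℝ) : ℂ) * I) = arg z * I := by
    have := Real.pi_ne_zero
    push_cast; field_simp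
  rw [clockwise, this, ← hz, norm_mul_exp_arg_mul_I]

/-- The mean of a function over the torus `|X| = |Y| = ε`. -/
noncomputable def torusMean (ε : ℝ) (f : ℂ → ℂ → ℂ) : ℂ :=
  ∫ t in (0 : ℝ)..1, circleAverage (f (clockwise ε t)) 0 ε

theorem integral_exp_int_mul {n : ℤ} (hn : n ≠ 0) (T : ℝ) {c : ℂ} (hc : c ≠ 0)
    (hT : c * T = 2 * π * I) : ∫ t in (0 : ℝ)..T, exp (n * c * t) = 0 := by
  rw [integral_exp_mul_complex (mul_ne_zero (Int.cast_ne_zero.2 hn) hc), mul_assoc, hT,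
    exp_int_mul_two_pi_mul_I]
  simp

theorem circleAverage_zpow (ε : ℝ) (n : ℤ) :
    circleAverage (fun z => z ^ n) 0 ε = if n = 0 then 1 else 0 := by
  split_ifs with h
  · simp only [h, zpow_zero]
    exact circleAverage_const 1 0 ε
  · have h1 : ∀ θ : ℝ, circleMap 0 ε θ ^ n = (ε : ℂ) ^ n * exp (n * I * θ) := fun θ => by
      rw [circleMap, zero_add, mul_zpow, ← exp_int_mul]
      congr 2; ring
    simp only [circleAverage_def, h1]
    rw [intervalIntegral.integral_const_mul, integral_exp_int_mul h _ I_ne_zero (by push_cast; ring),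
      mul_zero, smul_zero]

theorem integral_clockwise_zpow (ε : ℝ) (n : ℤ) :
    ∫ t in (0 : ℝ)..1, clockwise ε t ^ n = if n = 0 then 1 else 0 := by
  split_ifs with h
  · simp [h]
  · have h1 : ∀ t : ℝ, clockwise ε t ^ n = (ε : ℂ) ^ n * exp ((-n : ℤ) * (2 * π * I) * t) :=
      fun t => by
        rw [clockwise, mul_zpow, ← exp_int_mul]
        congr 2; push_cast; ring
    simp only [h1]
    rw [intervalIntegral.integral_const_mul, integral_exp_int_mul (neg_ne_zero.2 h) _
      two_pi_I_ne_zero (by push_cast; ring), mul_zero]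

theorem torusMean_zpow_mul_zpow (ε : ℝ) (a b : ℤ) :
    torusMean ε (fun X Y => X ^ a * Y ^ b) = if a = 0 ∧ b = 0 then 1 else 0 := by
  have h : ∀ X : ℂ, circleAverage (fun Y => X ^ a * Y ^ b) 0 ε =
      X ^ a * if b = 0 then 1 else 0 := fun X => by
    have := circleAverage_fun_smul (a := X ^ a) (f := fun z => z ^ b) (c := 0) (R := ε)
    simpa only [smul_eq_mul, circleAverage_zpow ε b] using this
  simp only [torusMean, h]
  rw [intervalIntegral.integral_mul_const, integral_clockwise_zpow]
  split_ifs <;> simp_all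

theorem continuous_circleAverage {f : ℂ → ℂ → ℂ} {ε : ℝ}
    (hf : Continuous fun p : ℝ × ℝ => f (clockwise ε p.1) (circleMap 0 ε p.2)) :
    Continuous fun t => circleAverage (f (clockwise ε t)) 0 ε := by
  simp only [circleAverage_def]
  exact (intervalIntegral.continuous_parametric_intervalIntegral_of_continuous'
    (f := fun t θ => f (clockwise ε t) (circleMap 0 ε θ)) hf _ _).const_smul _

theorem contDiff_circleAverage {f : ℂ → ℂ → ℂ} {ε : ℝ}
    (hf : ContDiff ℝ 1 fun p : ℝ × ℝ => f (clockwise ε p.1) (circleMap 0 ε p.2)) :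
    ContDiff ℝ 1 fun t => circleAverage (f (clockwise ε t)) 0 ε := by
  simp only [circleAverage_def]
  exact (contDiff_integral_of_contDiff hf _ _).const_smul _

theorem hasSum_integral_of_norm_le_geometric {F : ℕ → ℝ → ℂ} {f : ℝ → ℂ} {ρ : ℝ} (hρ : 0 ≤ ρ)
    (hρ1 : ρ < 1) (hF : ∀ n, Continuous (F n)) (hb : ∀ n t, ‖F n t‖ ≤ ρ ^ n)
    (hs : ∀ t, HasSum (fun n => F n t) (f t)) (a b : ℝ) :
    HasSum (fun n => ∫ t in a..b, F n t) (∫ t in a..b, f t) :=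
  intervalIntegral.hasSum_integral_of_dominated_convergence (fun n _ => ρ ^ n)
    (fun n => (hF n).aestronglyMeasurable) (fun n => .of_forall fun t _ => hb n t)
    (.of_forall fun _ _ => summable_geometric_of_lt_one hρ hρ1) intervalIntegrable_const
    (.of_forall fun t _ => hs t)

theorem norm_circleAverage_le {f : ℂ → ℂ} {ε C : ℝ} (h : ∀ θ, ‖f (circleMap 0 ε θ)‖ ≤ C) :
    ‖circleAverage f 0 ε‖ ≤ C := by
  rw [circleAverage_def, norm_smul, norm_inv, Real.norm_of_nonneg Real.two_pi_pos.le,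
    inv_mul_le_iff₀ Real.two_pi_pos]
  have := intervalIntegral.norm_integral_le_of_norm_le_const (a := 0) (b := 2 * π)
    (f := fun θ => f (circleMap 0 ε θ)) (C := C) (fun θ _ => h θ)
  rwa [sub_zero, abs_of_pos Real.two_pi_pos, mul_comm C] at this

/-- The torus mean of `-log (1 - ψ)`, for `|ψ|` bounded by a constant less than `1`. -/
theorem hasSum_torusMean_pow {ψ : ℂ → ℂ → ℂ} {ε ρ : ℝ} (hρ : 0 ≤ ρ) (hρ1 : ρ < 1)
    (hc : Continuous fun p : ℝ × ℝ => ψ (clockwise ε p.1) (circleMap 0 ε p.2))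
    (hb : ∀ t θ, ‖ψ (clockwise ε t) (circleMap 0 ε θ)‖ ≤ ρ) :
    HasSum (fun k : ℕ => 1 / ((k : ℂ) + 1) * torusMean ε (fun X Y => ψ X Y ^ (k + 1)))
      (∫ t in (0 : ℝ)..1, -circleAverage (fun Y => log (1 - ψ (clockwise ε t) Y)) 0 ε) := by
  have hlt : ∀ t θ, ‖ψ (clockwise ε t) (circleMap 0 ε θ)‖ < 1 := fun t θ => (hb t θ).trans_lt hρ1
  have hpow : ∀ (k : ℕ) t θ, ‖1 / ((k : ℂ) + 1) * ψ (clockwise ε t) (circleMap 0 ε θ) ^ (k + 1)‖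
      ≤ ρ ^ k := fun k t θ => by
    rw [norm_mul, norm_pow]
    have h1 : ‖1 / ((k : ℂ) + 1)‖ ≤ 1 := by
      rw [norm_div, norm_one, ← Nat.cast_succ, Complex.norm_natCast]
      exact div_le_one_of_le₀ (by push_cast; linarith [k.cast_nonneg (α := ℝ)]) (Nat.cast_nonneg _)
    have h2 : ‖ψ (clockwise ε t) (circleMap 0 ε θ)‖ ^ (k + 1) ≤ ρ ^ k := by
      rw [pow_succ]
      exact (mul_le_of_le_one_right (by positivity) (hlt t θ).le).trans
        (pow_le_pow_left₀ (norm_nonneg _) (hb t θ) k)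
    exact (mul_le_of_le_one_left (by positivity) h1).trans h2
  have hmul : ∀ (k : ℕ) t, 1 / ((k : ℂ) + 1) *
      circleAverage (fun Y => ψ (clockwise ε t) Y ^ (k + 1)) 0 ε =
      circleAverage (fun Y => 1 / ((k : ℂ) + 1) * ψ (clockwise ε t) Y ^ (k + 1)) 0 ε := by
    intro k t
    have := circleAverage_fun_smul (a := 1 / ((k : ℂ) + 1))
      (f := fun Y => ψ (clockwise ε t) Y ^ (k + 1)) (c := 0) (R := ε)
    simpa only [smul_eq_mul] using this.symm
  have hinner : ∀ t, HasSum
      (fun k : ℕ => 1 / ((k : ℂ) + 1) * circleAverage (fun Y => ψ (clockwise ε t) Y ^ (k + 1)) 0 ε)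
      (-circleAverage (fun Y => log (1 - ψ (clockwise ε t) Y)) 0 ε) := by
    intro t
    have hct : Continuous fun θ => ψ (clockwise ε t) (circleMap 0 ε θ) :=
      hc.comp (Continuous.prodMk_right t)
    have := hasSum_integral_of_norm_le_geometric hρ hρ1
      (F := fun k θ => 1 / ((k : ℂ) + 1) * ψ (clockwise ε t) (circleMap 0 ε θ) ^ (k + 1))
      (fun k => continuous_const.mul (hct.pow _)) (fun k θ => hpow k t θ)
      (fun θ => by
        have := hasSum_taylorSeries_neg_log' (hlt t θ)
        simpa only [div_eq_inv_mul, mul_one] using this) 0 (2 * π)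
    have h2 := this.const_smul ((2 * π)⁻¹)
    simp_rw [hmul, circleAverage_def]
    rw [← smul_neg, ← intervalIntegral.integral_neg]
    exact h2
  have hcc : ∀ k : ℕ, Continuous fun t =>
      circleAverage (fun Y => ψ (clockwise ε t) Y ^ (k + 1)) 0 ε := fun k =>
    continuous_circleAverage (f := fun X Y => ψ X Y ^ (k + 1)) (hc.pow _)
  have := hasSum_integral_of_norm_le_geometric hρ hρ1
    (F := fun k t => 1 / ((k : ℂ) + 1) * circleAverage (fun Y => ψ (clockwise ε t) Y ^ (k + 1)) 0 ε)
    (fun k => continuous_const.mul (hcc k))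
    (fun k t => by simp only [hmul]; exact norm_circleAverage_le fun θ => hpow k t θ) hinner 0 1
  simpa only [torusMean, intervalIntegral.integral_const_mul] using this

/-- A mean over a circle does not see the orientation. -/
theorem integral_clockwise_eq_circleAverage (f : ℂ → ℂ) (ε : ℝ) :
    ∫ t in (0 : ℝ)..1, f (clockwise ε t) = circleAverage f 0 ε := by
  have h1 : ∀ t : ℝ, clockwise ε t = circleMap 0 ε (2 * π - 2 * π * t) := fun t => by
    have : ((2 * π - 2 * π * t : ℝ) : ℂ) * I = -(2 * π * t * I) + 2 * π * I := by
      push_cast; ring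
    rw [circleMap, this, exp_add, exp_two_pi_mul_I, clockwise]; ring
  simp only [h1]
  rw [intervalIntegral.integral_comp_sub_mul (fun θ => f (circleMap 0 ε θ)) Real.two_pi_pos.ne',
    circleAverage_def]
  simp

end torus

/-! ### The root over the circle and the logarithm of `lam X Y`. -/

section root

open Complex
open scoped Real
open Real (circleAverage circleAverage_def circleAverage_fun_smul circleAverage_const)

/-- `Q` is dominated by the monomial `lam X Y` near the boundary of `|X| = ε ≥ |Y|`. -/
structure NodeDominated (Q : ℂ → ℂ → ℂ) (κ : ℕ) (lam : ℂ) (ε ρ : ℝ) : Prop where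
  pos : 0 < ε
  lt_one : ε < 1
  ratio_nonneg : 0 ≤ ρ
  ratio_lt_one : ρ < 1
  lam_ne_zero : lam ≠ 0
  contDiff : ContDiff ℂ 1 (Function.uncurry Q)
  norm_le : ∀ X Y, ‖X‖ = ε → ‖Y‖ ≤ ε → ‖Q X Y‖ ≤ ρ * (‖lam‖ * ε ^ 2)
  lipschitz : ∀ X Y Y', ‖X‖ = ε → ‖Y‖ ≤ ε → ‖Y'‖ ≤ ε →
    ‖Q X Y - Q X Y'‖ ≤ ρ * (‖lam‖ * ε) * ‖Y - Y'‖
  eval_zero : ∀ X, Q X 0 = (1 + X) ^ κ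

namespace NodeDominated

variable {Q : ℂ → ℂ → ℂ} {κ : ℕ} {lam : ℂ} {ε ρ : ℝ} (h : NodeDominated Q κ lam ε ρ)

include h

theorem norm_coeff_pos : 0 < ‖lam‖ * ε := mul_pos (norm_pos_iff.2 h.lam_ne_zero) h.pos

theorem coeff_ne_zero {X : ℂ} (hX : ‖X‖ = ε) : lam * X ≠ 0 :=
  norm_pos_iff.1 (by rw [norm_mul lam, hX]; exact h.norm_coeff_pos)

theorem ratio_mul_lt : ρ * (‖lam‖ * ε) < ‖lam‖ * ε :=
  mul_lt_of_lt_one_left h.norm_coeff_pos h.ratio_lt_one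

theorem root_unique {X Y Y' : ℂ} (hX : ‖X‖ = ε) (hY : ‖Y‖ ≤ ε) (hY' : ‖Y'‖ ≤ ε)
    (e : lam * X * Y = Q X Y) (e' : lam * X * Y' = Q X Y') : Y = Y' := by
  by_contra hne
  have h1 := h.lipschitz X Y Y' hX hY hY'
  rw [← e, ← e', ← mul_sub, norm_mul, norm_mul lam, hX] at h1
  exact absurd (le_of_mul_le_mul_right h1 (norm_pos_iff.2 (sub_ne_zero.2 hne)))
    (not_le.2 h.ratio_mul_lt)

theorem exists_root {X : ℂ} (hX : ‖X‖ = ε) : ∃ Y, ‖Y‖ < ε ∧ lam * X * Y = Q X Y := by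
  -- The roots are the fixed points of `G`, which maps the closed disc into the open one and
  -- contracts with ratio `ρ`.
  set G : ℂ → ℂ := fun Y => Q X Y / (lam * X) with hG
  have hlt : ∀ Y, ‖Y‖ ≤ ε → ‖G Y‖ < ε := fun Y hY => by
    rw [hG, norm_div, norm_mul lam, hX, div_lt_iff₀ h.norm_coeff_pos]
    refine (h.norm_le X Y hX hY).trans_lt ?_
    nlinarith [mul_lt_mul_of_pos_right h.ratio_mul_lt h.pos]
  have hmaps : MapsTo G (closedBall 0 ε) (closedBall 0 ε) := fun Y hY =>
    mem_closedBall_zero_iff.2 (hlt Y (mem_closedBall_zero_iff.1 hY)).le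
  have hcontr : ContractingWith ⟨ρ, h.ratio_nonneg⟩ (hmaps.restrict G _ _) := by
    refine ⟨h.ratio_lt_one, LipschitzWith.of_dist_le_mul fun Y Y' => ?_⟩
    rw [Subtype.dist_eq, Subtype.dist_eq, dist_eq_norm, dist_eq_norm]
    change ‖G Y - G Y'‖ ≤ ρ * ‖(Y : ℂ) - Y'‖
    rw [hG, ← sub_div, norm_div, norm_mul lam, hX, div_le_iff₀ h.norm_coeff_pos]
    refine (h.lipschitz X Y Y' hX (mem_closedBall_zero_iff.1 Y.2)
      (mem_closedBall_zero_iff.1 Y'.2)).trans_eq ?_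
    ring
  obtain ⟨Y, hY, hfix, -⟩ := hcontr.exists_fixedPoint' (isClosed_closedBall.isComplete) hmaps
    (mem_closedBall_self h.pos.le) (edist_ne_top _ _)
  have hfix' : G Y = Y := hfix
  refine ⟨Y, hfix' ▸ hlt Y (mem_closedBall_zero_iff.1 hY), ?_⟩
  rw [mul_comm, ← eq_div_iff (h.coeff_ne_zero hX)]
  exact hfix'.symm

theorem one_add_ne_zero {X : ℂ} (hX : ‖X‖ = ε) : 1 + X ≠ 0 := by
  intro h0
  have : X = -1 := by linear_combination h0
  rw [this, norm_neg, norm_one] at hX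
  exact h.lt_one.ne hX.symm

/-- At `Y = 0` the equation would read `(1 + X) ^ κ = 0`, which `‖X‖ < 1` excludes. -/
theorem root_ne_zero {X Y : ℂ} (hX : ‖X‖ = ε) (e : lam * X * Y = Q X Y) : Y ≠ 0 := by
  rintro rfl
  rw [mul_zero, h.eval_zero] at e
  exact pow_ne_zero _ (h.one_add_ne_zero hX) e.symm

theorem norm_quotient_le {X Y : ℂ} (hX : ‖X‖ = ε) (hY : ‖Y‖ = ε) :
    ‖Q X Y / (lam * X * Y)‖ ≤ ρ := by
  have h0 : 0 < ‖lam‖ * ε * ε := mul_pos h.norm_coeff_pos h.pos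
  rw [norm_div, norm_mul, norm_mul lam, hX, hY, div_le_iff₀ h0]
  exact (h.norm_le X Y hX hY.le).trans_eq (by ring)

theorem contDiff_quotient : ContDiff ℝ 1 fun p : ℝ × ℝ =>
    Q (clockwise ε p.1) (circleMap 0 ε p.2) / (lam * clockwise ε p.1 * circleMap 0 ε p.2) := by
  have h1 : ContDiff ℝ 1 fun p : ℝ × ℝ => clockwise ε p.1 := (contDiff_clockwise ε).comp contDiff_fst
  have h2 : ContDiff ℝ 1 fun p : ℝ × ℝ => circleMap 0 ε p.2 :=
    (contDiff_circleMap 0 ε).comp contDiff_snd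
  have h3 : ContDiff ℝ 1 fun p : ℝ × ℝ => Q (clockwise ε p.1) (circleMap 0 ε p.2) :=
    (h.contDiff.restrict_scalars ℝ).comp (h1.prodMk h2)
  simp only [div_eq_mul_inv]
  exact h3.mul (((contDiff_const.mul h1).mul h2).inv fun p => mul_ne_zero
    (h.coeff_ne_zero (norm_clockwise h.pos _)) (circleMap_ne_center h.pos.ne'))

omit h in
/-- The logarithm of `lam X Y` along the curve. -/
noncomputable def logNode (Q : ℂ → ℂ → ℂ) (κ : ℕ) (lam : ℂ) (ε t : ℝ) : ℂ :=
  κ * log (1 + clockwise ε t) -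
    circleAverage (fun Y => log (1 - Q (clockwise ε t) Y / (lam * clockwise ε t * Y))) 0 ε

theorem one_add_clockwise_mem_slitPlane (t : ℝ) : 1 + clockwise ε t ∈ slitPlane := by
  rw [← sub_neg_eq_add]
  exact one_sub_mem_slitPlane (by rw [norm_neg, norm_clockwise h.pos]; exact h.lt_one)

/-- Differentiation under the integral sign; the regularity of the curve follows from it without the
implicit function theorem. -/
theorem contDiff_logNode : ContDiff ℝ 1 (logNode Q κ lam ε) := by
  refine ContDiff.sub (contDiff_const.mul (contDiff_clog (contDiff_const.add (contDiff_clockwise ε))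
    h.one_add_clockwise_mem_slitPlane)) ?_
  refine contDiff_circleAverage (f := fun X Y => log (1 - Q X Y / (lam * X * Y))) ?_
  refine contDiff_clog (contDiff_const.sub h.contDiff_quotient) fun p => one_sub_mem_slitPlane ?_
  refine (h.norm_quotient_le (norm_clockwise h.pos _) ?_).trans_lt h.ratio_lt_one
  rw [norm_circleMap_zero, abs_of_pos h.pos]

omit h in
theorem logNode_periodic (t : ℝ) : logNode Q κ lam ε (t + 1) = logNode Q κ lam ε t := by
  simp only [logNode, clockwise_periodic]

/-- By `circleAverage_log_one_sub_quotient` the mean in `logNode` is `log ((1 + X) ^ κ / (lam X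
Y))`, and exponentiating cancels `(1 + X) ^ κ`. -/
theorem exp_logNode {t : ℝ} {Y : ℂ} (hY : ‖Y‖ < ε)
    (e : lam * clockwise ε t * Y = Q (clockwise ε t) Y) :
    exp (logNode Q κ lam ε t) = lam * clockwise ε t * Y := by
  have hX := norm_clockwise h.pos t
  have hY0 := h.root_ne_zero hX e
  have hq : Differentiable ℂ (Q (clockwise ε t)) :=
    ((h.contDiff.differentiable one_ne_zero).comp
      ((differentiable_const (clockwise ε t)).prodMk differentiable_id))
  have := circleAverage_log_one_sub_quotient hq (c := lam * clockwise ε t) h.pos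
    (K := ρ * (‖lam‖ * ε)) (by rw [norm_mul lam, hX]; exact h.ratio_mul_lt)
    (fun y y' hy hy' => h.lipschitz _ y y' hX hy hy') hY hY0 e
  have hc0 := mul_ne_zero (h.coeff_ne_zero hX) hY0
  have hp0 := pow_ne_zero κ (h.one_add_ne_zero hX)
  rw [logNode, this, exp_sub, h.eval_zero, exp_log (div_ne_zero hp0 hc0), exp_nat_mul,
    exp_log (h.one_add_ne_zero hX), div_div_cancel₀ hp0]

theorem exp_logNode_div {t : ℝ} :
    ‖exp (logNode Q κ lam ε t) / (lam * clockwise ε t)‖ < ε ∧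
    lam * clockwise ε t * (exp (logNode Q κ lam ε t) / (lam * clockwise ε t)) =
      Q (clockwise ε t) (exp (logNode Q κ lam ε t) / (lam * clockwise ε t)) := by
  obtain ⟨Y, hY, e⟩ := h.exists_root (norm_clockwise h.pos t)
  rw [h.exp_logNode hY e, mul_div_cancel_left₀ _ (h.coeff_ne_zero (norm_clockwise h.pos t))]
  exact ⟨hY, e⟩

theorem hasSum_integral_logNode :
    HasSum (fun k : ℕ => 1 / ((k : ℂ) + 1) *
      torusMean ε (fun X Y => (Q X Y / (lam * X * Y)) ^ (k + 1)))
      (∫ t in (0 : ℝ)..1, logNode Q κ lam ε t) := by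
  have hb : ∀ t θ, ‖Q (clockwise ε t) (circleMap 0 ε θ) /
      (lam * clockwise ε t * circleMap 0 ε θ)‖ ≤ ρ := fun t θ =>
    h.norm_quotient_le (norm_clockwise h.pos _) (by rw [norm_circleMap_zero, abs_of_pos h.pos])
  have hlog : Continuous fun t => (κ : ℂ) * log (1 + clockwise ε t) :=
    (contDiff_const.mul (contDiff_clog (contDiff_const.add (contDiff_clockwise ε (n := 0)))
      h.one_add_clockwise_mem_slitPlane)).continuous
  have hsum := hasSum_torusMean_pow h.ratio_nonneg h.ratio_lt_one
    (ψ := fun X Y => Q X Y / (lam * X * Y)) h.contDiff_quotient.continuous hb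
  convert! hsum using 1
  -- The mean of `log (1 + X)` is its value at `X = 0`, so the factor from the side does not
  -- contribute.
  have h0 : ∫ t in (0 : ℝ)..1, (κ : ℂ) * log (1 + clockwise ε t) = 0 := by
    rw [intervalIntegral.integral_const_mul,
      integral_clockwise_eq_circleAverage (fun X => log (1 + X)) ε]
    have := circleAverage_log_one_sub_mul (a := -1) (r := ε)
      (by rw [norm_neg, norm_one, one_mul, abs_of_pos h.pos]; exact h.lt_one)
    simp only [neg_mul, one_mul, sub_neg_eq_add] at this
    rw [this, mul_zero]
  have hcont : Continuous fun t =>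
      circleAverage (fun Y => log (1 - Q (clockwise ε t) Y / (lam * clockwise ε t * Y))) 0 ε := by
    have := hlog.sub h.contDiff_logNode.continuous
    simpa only [logNode, Pi.sub_def, sub_sub_cancel] using this
  simp only [logNode]
  rw [intervalIntegral.integral_sub (hlog.intervalIntegrable _ _) (hcont.intervalIntegrable _ _),
    h0, zero_sub, intervalIntegral.integral_neg]

end NodeDominated

end root

end

section

/-! ## Estimates; evaluation of Laurent polynomials -/

open Set Filter Topology Metric

section estimates

theorem norm_pow_succ_sub_le {Y Y' : ℂ} {ε : ℝ} (hY : ‖Y‖ ≤ ε) (hY' : ‖Y'‖ ≤ ε) (k : ℕ) :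
    ‖Y ^ (k + 1) - Y' ^ (k + 1)‖ ≤ (k + 1) * ε ^ k * ‖Y - Y'‖ := by
  induction k with
  | zero => simp
  | succ k ih =>
    have e : Y ^ (k + 1 + 1) - Y' ^ (k + 1 + 1) =
        Y ^ (k + 1) * (Y - Y') + (Y ^ (k + 1) - Y' ^ (k + 1)) * Y' := by ring
    have h0 : 0 ≤ ε := (norm_nonneg _).trans hY
    have h1 : ‖Y ^ (k + 1) * (Y - Y')‖ ≤ ε ^ (k + 1) * ‖Y - Y'‖ := by
      rw [norm_mul, norm_pow]; gcongr
    have h2 : ‖(Y ^ (k + 1) - Y' ^ (k + 1)) * Y'‖ ≤ ((k + 1) * ε ^ k * ‖Y - Y'‖) * ε := by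
      rw [norm_mul]; gcongr
    rw [e]
    refine (norm_add_le _ _).trans ((add_le_add h1 h2).trans_eq ?_)
    push_cast; ring

theorem norm_monomial_le {X Y c : ℂ} {ε : ℝ} (hX : ‖X‖ = ε) (hY : ‖Y‖ ≤ ε) (s t : ℕ) :
    ‖c * (X ^ s * Y ^ t)‖ ≤ ‖c‖ * ε ^ (s + t) := by
  rw [norm_mul, norm_mul, norm_pow, norm_pow, hX, pow_add]
  have : 0 ≤ ε := (norm_nonneg _).trans hY
  gcongr

theorem norm_monomial_sub_le {X Y Y' c : ℂ} {ε : ℝ} (hX : ‖X‖ = ε) (hY : ‖Y‖ ≤ ε)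
    (hY' : ‖Y'‖ ≤ ε) (s t : ℕ) :
    ‖c * (X ^ s * Y ^ (t + 1)) - c * (X ^ s * Y' ^ (t + 1))‖ ≤
      ‖c‖ * ((t + 1) * ε ^ (s + t)) * ‖Y - Y'‖ := by
  rw [← mul_sub, ← mul_sub, norm_mul, norm_mul, norm_pow, hX]
  have : 0 ≤ ε := (norm_nonneg _).trans hY
  calc ‖c‖ * (ε ^ s * ‖Y ^ (t + 1) - Y' ^ (t + 1)‖)
      ≤ ‖c‖ * (ε ^ s * ((t + 1) * ε ^ t * ‖Y - Y'‖)) := by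
        gcongr; exact norm_pow_succ_sub_le hY hY' t
    _ = _ := by rw [pow_add]; ring

/-- If `s + t = 2`, then `t ≤ 1` and the factor is at most `2`; otherwise there is a further power
of `ε`. The constant `2` is uniform, and the part that depends on the exponents becomes small with
`ε`. -/
theorem succ_mul_pow_le {ε : ℝ} (h0 : 0 ≤ ε) (h1 : ε ≤ 1) {s t : ℕ} (hs : 1 ≤ s)
    (hst : 2 ≤ s + t) : ((t : ℝ) + 1) * ε ^ (s + t) ≤ ε ^ 2 * (2 + ε * (t + 1)) := by
  rcases hst.eq_or_lt with h | h
  · have ht : (t : ℝ) ≤ 1 := by exact_mod_cast (by omega : t ≤ 1)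
    rw [← h, mul_comm]
    refine mul_le_mul_of_nonneg_left ?_ (sq_nonneg ε)
    nlinarith [t.cast_nonneg (α := ℝ), mul_nonneg h0 (t.cast_nonneg (α := ℝ))]
  · have h3 : ε ^ (s + t) ≤ ε ^ 3 := pow_le_pow_of_le_one h0 h1 h
    calc ((t : ℝ) + 1) * ε ^ (s + t) ≤ (t + 1) * ε ^ 3 := by gcongr
      _ = ε ^ 2 * (ε * (t + 1)) := by ring
      _ ≤ _ := by gcongr; linarith

/-- A power of `1 + X`, plus monomials in the ideal `(Y)` with bounded coefficients, plus monomials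
of degree at least `3` in the ideal `(X Y)` with coefficients of size at most `1 / (c ε ^ 3)`, is
dominated by `lam X Y` if `|lam| > c / ε ^ 2`. The exponents of `Y` are shifted by one. -/
theorem exists_nodeDominated {β γ : Type*} (κ : ℕ) (B : Finset β) (C : β → ℂ) (s t : β → ℕ)
    (J : Finset γ) (s' t' : γ → ℕ) (hs' : ∀ j ∈ J, 1 ≤ s' j) (hst' : ∀ j ∈ J, 2 ≤ s' j + t' j)
    {c : ℝ} (hc : 3 ≤ c) (hJ : (J.card : ℝ) ≤ c) :
    ∃ ε₀ : ℝ, 0 < ε₀ ∧ ∀ ε : ℝ, 0 < ε → ε < ε₀ → ∀ (lam : ℂ) (μ : γ → ℂ),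
      c / ε ^ 2 < ‖lam‖ → (∀ j ∈ J, ‖μ j‖ < 1 / (c * ε ^ 3)) →
      NodeDominated (fun X Y => (1 + X) ^ κ + ∑ b ∈ B, C b * (X ^ s b * Y ^ (t b + 1)) -
        ∑ j ∈ J, μ j * (X ^ s' j * Y ^ (t' j + 1))) κ lam ε (5 / 6) := by
  set K₀ : ℝ := ∑ b ∈ B, ‖C b‖ with hK₀
  set K₁ : ℝ := ∑ b ∈ B, ‖C b‖ * (t b + 1) with hK₁
  set T : ℝ := ∑ j ∈ J, ((t' j : ℝ) + 1) with hT
  have hT0 : 0 ≤ T := Finset.sum_nonneg fun _ _ => by positivity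
  -- Origin of `5 / 6`: the size of the sum is below `3/2 + 1`, and `ε` times its Lipschitz constant
  -- is below `1/2 + 2`. Both are `5/2 = (5/6) · 3`, while `‖lam‖ ε ^ 2 > c ≥ 3`.
  have e1 : ∀ᶠ ε : ℝ in 𝓝 0, (1 + ε) ^ κ + ε * K₀ < 3 / 2 := by
    have : Continuous fun ε : ℝ => (1 + ε) ^ κ + ε * K₀ := by fun_prop
    exact this.continuousAt.eventually (eventually_lt_nhds (by norm_num))
  have e2 : ∀ᶠ ε : ℝ in 𝓝 0, ε * K₁ + ε * T < 1 / 2 := by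
    have : Continuous fun ε : ℝ => ε * K₁ + ε * T := by fun_prop
    exact this.continuousAt.eventually (eventually_lt_nhds (by norm_num))
  obtain ⟨ε₀, hε₀, hE⟩ := Metric.eventually_nhds_iff.1
    ((e1.and e2).and (eventually_lt_nhds (zero_lt_one (α := ℝ))))
  refine ⟨ε₀, hε₀, fun ε hε hlt lam μ hlam hμ => ?_⟩
  obtain ⟨⟨h1, h2⟩, h3⟩ := hE (y := ε) (by rwa [Real.dist_eq, sub_zero, abs_of_pos hε])
  have hcpos : 0 < c := by linarith
  have hlam2 : c < ‖lam‖ * ε ^ 2 := (div_lt_iff₀ (by positivity)).1 hlam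
  have hlam0 : lam ≠ 0 := by
    rintro rfl
    rw [norm_zero, zero_mul] at hlam2
    linarith
  refine ⟨hε, h3, by norm_num, by norm_num, hlam0, ?_, ?_, ?_, ?_⟩
  · simp only [Function.uncurry_def]
    fun_prop
  · intro X Y hX hY
    have n1 : ‖(1 + X) ^ κ‖ ≤ (1 + ε) ^ κ := by
      rw [norm_pow]
      gcongr
      exact (norm_add_le _ _).trans_eq (by rw [norm_one, hX])
    have n2 : ‖∑ b ∈ B, C b * (X ^ s b * Y ^ (t b + 1))‖ ≤ ε * K₀ := by
      rw [hK₀, Finset.mul_sum]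
      refine norm_sum_le_of_le _ fun b _ => (norm_monomial_le hX hY _ _).trans ?_
      rw [mul_comm]
      gcongr
      exact pow_le_of_le_one hε.le h3.le (by omega)
    -- Each monomial has degree at least `3`, so each term is at most `1 / c`, and there are at most
    -- `c` terms.
    have n3 : ‖∑ j ∈ J, μ j * (X ^ s' j * Y ^ (t' j + 1))‖ ≤ 1 := by
      have : ‖∑ j ∈ J, μ j * (X ^ s' j * Y ^ (t' j + 1))‖ ≤ ∑ j ∈ J, 1 / c := by
        refine norm_sum_le_of_le _ fun j hj => (norm_monomial_le hX hY _ _).trans ?_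
        calc ‖μ j‖ * ε ^ (s' j + (t' j + 1)) ≤ 1 / (c * ε ^ 3) * ε ^ 3 := by
              exact mul_le_mul (hμ j hj).le
                (pow_le_pow_of_le_one hε.le h3.le (by have := hst' j hj; omega))
                (by positivity) (by positivity)
          _ = 1 / c := by field_simp
      refine this.trans ?_
      rw [Finset.sum_const, nsmul_eq_mul, mul_one_div, div_le_one hcpos]
      exact hJ
    refine (norm_sub_le _ _).trans ((add_le_add (norm_add_le _ _) le_rfl).trans ?_)
    linarith
  · intro X Y Y' hX hY hY'
    have n2 : ‖∑ b ∈ B, C b * (X ^ s b * Y ^ (t b + 1)) - ∑ b ∈ B, C b * (X ^ s b * Y' ^ (t b + 1))‖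
        ≤ K₁ * ‖Y - Y'‖ := by
      rw [hK₁, Finset.sum_mul, ← Finset.sum_sub_distrib]
      refine norm_sum_le_of_le _ fun b _ => (norm_monomial_sub_le hX hY hY' _ _).trans ?_
      gcongr
      exact mul_le_of_le_one_right (by positivity) (pow_le_one₀ hε.le h3.le)
    have n3 : ‖∑ j ∈ J, μ j * (X ^ s' j * Y ^ (t' j + 1)) - ∑ j ∈ J, μ j * (X ^ s' j * Y' ^ (t' j + 1))‖
        ≤ ((2 + ε * T) / ε) * ‖Y - Y'‖ := by
      have hsum : ∑ j ∈ J, 1 / (c * ε) * (2 + ε * ((t' j : ℝ) + 1)) ≤ (2 + ε * T) / ε := by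
        rw [← Finset.mul_sum, Finset.sum_add_distrib, ← Finset.mul_sum, ← hT, Finset.sum_const,
          nsmul_eq_mul, one_div_mul_eq_div, div_le_div_iff₀ (by positivity) hε]
        have : (J.card * 2 + ε * T : ℝ) ≤ (2 + ε * T) * c := by
          nlinarith [mul_nonneg hε.le hT0]
        nlinarith
      refine le_trans ?_ (mul_le_mul_of_nonneg_right hsum (norm_nonneg _))
      rw [Finset.sum_mul, ← Finset.sum_sub_distrib]
      refine norm_sum_le_of_le _ fun j hj => (norm_monomial_sub_le hX hY hY' _ _).trans ?_
      refine mul_le_mul_of_nonneg_right ?_ (norm_nonneg _)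
      calc ‖μ j‖ * (((t' j : ℝ) + 1) * ε ^ (s' j + t' j))
          ≤ 1 / (c * ε ^ 3) * (ε ^ 2 * (2 + ε * (t' j + 1))) := by
            exact mul_le_mul (hμ j hj).le (succ_mul_pow_le hε.le h3.le (hs' j hj) (hst' j hj))
              (by positivity) (by positivity)
        _ = 1 / (c * ε) * (2 + ε * (t' j + 1)) := by field_simp
    have hconst : K₁ + (2 + ε * T) / ε ≤ 5 / 6 * (‖lam‖ * ε) := by
      rw [← mul_le_mul_iff_left₀ hε, add_mul, div_mul_cancel₀ _ hε.ne']
      nlinarith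
    refine le_trans ?_ (mul_le_mul_of_nonneg_right hconst (norm_nonneg _))
    rw [add_mul]
    refine le_trans (le_of_eq_of_le ?_ (norm_sub_le _ _)) (add_le_add n2 n3)
    congr 1
    ring
  · intro X
    simp

end estimates

/-! ### Toric coordinates and constant terms. -/

section laurent

/-- Evaluation of Laurent polynomials at a point of `(ℂ \ {0})²`. -/
noncomputable def laurentEvalHom (z : ℂ × ℂ) (h₁ : z.1 ≠ 0) (h₂ : z.2 ≠ 0) : Laurent₂ →ₐ[ℂ] ℂ :=
  AddMonoidAlgebra.lift ℂ ℂ (ℤ × ℤ)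
    { toFun := fun p => monomialAt p.toAdd z
      map_one' := by simp [monomialAt]
      map_mul' := fun p q => by
        simp only [monomialAt, toAdd_mul, Prod.fst_add, Prod.snd_add, zpow_add₀ h₁, zpow_add₀ h₂]
        ring }

variable {z : ℂ × ℂ}

theorem laurentEvalHom_apply (h₁ : z.1 ≠ 0) (h₂ : z.2 ≠ 0) (f : Laurent₂) :
    laurentEvalHom z h₁ h₂ f = laurentEval f z := by
  rw [laurentEvalHom, AddMonoidAlgebra.lift_apply]
  rfl

theorem laurentEval_monomial (p : ℤ × ℤ) (c : ℂ) (z : ℂ × ℂ) :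
    laurentEval (laurentMonomial p c) z = c * monomialAt p z := by
  simp [laurentEval, laurentMonomial]

theorem monomialAt_add (h₁ : z.1 ≠ 0) (h₂ : z.2 ≠ 0) (p q : ℤ × ℤ) :
    monomialAt (p + q) z = monomialAt p z * monomialAt q z := by
  simp only [monomialAt, Prod.fst_add, Prod.snd_add, zpow_add₀ h₁, zpow_add₀ h₂]
  ring

theorem monomialAt_zsmul (k : ℤ) (p : ℤ × ℤ) (z : ℂ × ℂ) :
    monomialAt (k • p) z = monomialAt p z ^ k := by
  simp only [monomialAt, Prod.smul_fst, Prod.smul_snd, smul_eq_mul, mul_zpow, ← zpow_mul, mul_comm k]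

theorem monomialAt_ne_zero (h₁ : z.1 ≠ 0) (h₂ : z.2 ≠ 0) (p : ℤ × ℤ) : monomialAt p z ≠ 0 :=
  mul_ne_zero (zpow_ne_zero _ h₁) (zpow_ne_zero _ h₂)

/-- The point of `(ℂ \ {0})²` with toric coordinates `X`, `Y` with respect to the basis `u, v`. -/
noncomputable def toricPoint (u v : ℤ × ℤ) (X Y : ℂ) : ℂ × ℂ :=
  (X ^ v.2 * Y ^ (-u.2), X ^ (-v.1) * Y ^ u.1)

variable {u v : ℤ × ℤ} {X Y : ℂ}

theorem toricPoint_fst_ne_zero (hX : X ≠ 0) (hY : Y ≠ 0) : (toricPoint u v X Y).1 ≠ 0 :=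
  mul_ne_zero (zpow_ne_zero _ hX) (zpow_ne_zero _ hY)

theorem toricPoint_snd_ne_zero (hX : X ≠ 0) (hY : Y ≠ 0) : (toricPoint u v X Y).2 ≠ 0 :=
  mul_ne_zero (zpow_ne_zero _ hX) (zpow_ne_zero _ hY)

theorem monomialAt_toricPoint (hX : X ≠ 0) (hY : Y ≠ 0) (p : ℤ × ℤ) :
    monomialAt p (toricPoint u v X Y) = X ^ latticeDet p v * Y ^ latticeDet u p := by
  have e1 : latticeDet p v = v.2 * p.1 + -v.1 * p.2 := by simp only [latticeDet]; ring
  have e2 : latticeDet u p = -u.2 * p.1 + u.1 * p.2 := by simp only [latticeDet]; ring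
  rw [e1, e2, zpow_add₀ hX, zpow_add₀ hY]
  simp only [monomialAt, toricPoint, mul_zpow, ← zpow_mul]
  ring

theorem toricPoint_monomialAt (huv : latticeDet u v = 1) (h₁ : z.1 ≠ 0) (h₂ : z.2 ≠ 0) :
    toricPoint u v (monomialAt u z) (monomialAt v z) = z := by
  simp only [latticeDet] at huv
  have e : ∀ a b : ℤ, monomialAt u z ^ a * monomialAt v z ^ b =
      z.1 ^ (u.1 * a + v.1 * b) * z.2 ^ (u.2 * a + v.2 * b) := fun a b => by
    simp only [monomialAt, mul_zpow, ← zpow_mul, zpow_add₀ h₁, zpow_add₀ h₂]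
    ring
  apply Prod.ext
  · change monomialAt u z ^ v.2 * monomialAt v z ^ (-u.2) = z.1
    rw [e, show u.1 * v.2 + v.1 * -u.2 = 1 by linear_combination huv,
      show u.2 * v.2 + v.2 * -u.2 = 0 by ring]
    simp
  · change monomialAt u z ^ (-v.1) * monomialAt v z ^ u.1 = z.2
    rw [e, show u.1 * -v.1 + v.1 * u.1 = 0 by ring,
      show u.2 * -v.1 + v.2 * u.1 = 1 by linear_combination huv]
    simp

theorem latticeDet_self (p : ℤ × ℤ) : latticeDet p p = 0 := by simp only [latticeDet]; ring

theorem monomialAt_toricPoint_left (huv : latticeDet u v = 1) (hX : X ≠ 0) (hY : Y ≠ 0) :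
    monomialAt u (toricPoint u v X Y) = X := by
  rw [monomialAt_toricPoint hX hY, huv, latticeDet_self]; simp

theorem monomialAt_toricPoint_right (huv : latticeDet u v = 1) (hX : X ≠ 0) (hY : Y ≠ 0) :
    monomialAt v (toricPoint u v X Y) = Y := by
  rw [monomialAt_toricPoint hX hY, huv, latticeDet_self]; simp

/-- Cramer's rule for a basis of determinant `1`. -/
theorem eq_add_smul_add_smul (huv : latticeDet u v = 1) (p q : ℤ × ℤ) :
    q = p + latticeDet (q - p) v • u + latticeDet u (q - p) • v := by
  simp only [latticeDet] at huv ⊢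
  apply Prod.ext
  · simp only [Prod.fst_add, Prod.smul_fst, smul_eq_mul, Prod.fst_sub, Prod.snd_sub]
    linear_combination (p.1 - q.1) * huv
  · simp only [Prod.snd_add, Prod.smul_snd, smul_eq_mul, Prod.fst_sub, Prod.snd_sub]
    linear_combination (p.2 - q.2) * huv

theorem monomialAt_eq_mul (huv : latticeDet u v = 1) (h₁ : z.1 ≠ 0) (h₂ : z.2 ≠ 0) (p q : ℤ × ℤ) :
    monomialAt q z = monomialAt p z *
      (monomialAt u z ^ latticeDet (q - p) v * monomialAt v z ^ latticeDet u (q - p)) := by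
  conv_lhs => rw [eq_add_smul_add_smul huv p q]
  rw [monomialAt_add h₁ h₂, monomialAt_add h₁ h₂, monomialAt_zsmul, monomialAt_zsmul, mul_assoc]

theorem continuous_laurentEval_toricPoint {ε : ℝ} (hε : 0 < ε) (f : Laurent₂) :
    Continuous fun p : ℝ × ℝ =>
      laurentEval f (toricPoint u v (clockwise ε p.1) (circleMap 0 ε p.2)) := by
  have h1 : Continuous fun p : ℝ × ℝ => clockwise ε p.1 :=
    (contDiff_clockwise ε (n := 0)).continuous.comp continuous_fst
  have h2 : Continuous fun p : ℝ × ℝ => circleMap 0 ε p.2 :=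
    (continuous_circleMap 0 ε).comp continuous_snd
  simp only [laurentEval, Finsupp.sum]
  refine continuous_finsetSum _ fun q _ => continuous_const.mul ?_
  simp only [monomialAt_toricPoint (clockwise_ne_zero hε _) (circleMap_ne_center hε.ne')]
  exact (h1.zpow₀ _ fun p => Or.inl (clockwise_ne_zero hε _)).mul
    (h2.zpow₀ _ fun p => Or.inl (circleMap_ne_center hε.ne'))

theorem torusMean_add {f g : ℂ → ℂ → ℂ} {ε : ℝ}
    (hf : Continuous fun p : ℝ × ℝ => f (clockwise ε p.1) (circleMap 0 ε p.2))
    (hg : Continuous fun p : ℝ × ℝ => g (clockwise ε p.1) (circleMap 0 ε p.2)) :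
    torusMean ε (fun X Y => f X Y + g X Y) = torusMean ε f + torusMean ε g := by
  rw [torusMean, torusMean, torusMean, ← intervalIntegral.integral_add
    ((continuous_circleAverage hf).intervalIntegrable _ _)
    ((continuous_circleAverage hg).intervalIntegrable _ _)]
  refine intervalIntegral.integral_congr fun t _ => ?_
  exact Real.circleAverage_fun_add
    ((hf.comp (Continuous.prodMk_right t)).intervalIntegrable _ _)
    ((hg.comp (Continuous.prodMk_right t)).intervalIntegrable _ _)

theorem torusMean_congr {f g : ℂ → ℂ → ℂ} {ε : ℝ} (hε : 0 < ε)
    (h : ∀ X Y, ‖X‖ = ε → ‖Y‖ = ε → f X Y = g X Y) : torusMean ε f = torusMean ε g := by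
  refine intervalIntegral.integral_congr fun t _ => Real.circleAverage_congr_sphere fun Y hY => ?_
  exact h _ _ (norm_clockwise hε t) (by simpa [abs_of_pos hε] using hY)

theorem torusMean_const_mul (c : ℂ) (f : ℂ → ℂ → ℂ) (ε : ℝ) :
    torusMean ε (fun X Y => c * f X Y) = c * torusMean ε f := by
  rw [torusMean, torusMean, ← intervalIntegral.integral_const_mul]
  refine intervalIntegral.integral_congr fun t _ => ?_
  have := Real.circleAverage_fun_smul (a := c) (f := f (clockwise ε t)) (c := 0) (R := ε)
  simpa only [smul_eq_mul] using this

/-- The constant term of a Laurent polynomial is its mean over a torus. -/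
theorem torusMean_laurentEval (huv : latticeDet u v = 1) {ε : ℝ} (hε : 0 < ε) (f : Laurent₂) :
    torusMean ε (fun X Y => laurentEval f (toricPoint u v X Y)) = constantTerm f := by
  induction f using AddMonoidAlgebra.induction_linear with
  | zero => simp [laurentEval, torusMean, constantTerm, Real.circleAverage_const]
  | add f g hf hg =>
    have e : ∀ z, laurentEval (f + g) z = laurentEval f z + laurentEval g z := fun z => by
      simp only [laurentEval, AddMonoidAlgebra.coeff_add]
      exact Finsupp.sum_add_index' (by simp) fun _ _ _ => add_mul _ _ _
    simp only [e]
    rw [torusMean_add (f := fun X Y => laurentEval f (toricPoint u v X Y))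
      (g := fun X Y => laurentEval g (toricPoint u v X Y))
      (continuous_laurentEval_toricPoint hε f) (continuous_laurentEval_toricPoint hε g), hf, hg]
    simp [constantTerm]
  | single p c =>
    have e := laurentEval_monomial p c
    rw [laurentMonomial] at e
    simp only [e]
    rw [torusMean_const_mul, torusMean_congr hε (g := fun X Y => X ^ latticeDet p v * Y ^ latticeDet u p),
      torusMean_zpow_mul_zpow]
    · have hp : (latticeDet p v = 0 ∧ latticeDet u p = 0) ↔ p = 0 := by
        constructor
        · rintro ⟨h1, h2⟩
          have := eq_add_smul_add_smul huv 0 p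
          simpa [h1, h2] using this
        · rintro rfl
          simp [latticeDet]
      simp only [hp, constantTerm, AddMonoidAlgebra.coeff_single, Finsupp.single_apply]
      split_ifs <;> simp
    · intro X Y hX hY
      exact monomialAt_toricPoint (norm_pos_iff.1 (hX ▸ hε)) (norm_pos_iff.1 (hY ▸ hε)) p

end laurent

end

section

/-! ## The polygon in the coordinates of a corner -/

open Set Filter Topology

namespace LatticePolygon

section polygon

variable {n : ℕ} (P : LatticePolygon n)

theorem fin_add_one_ne (i : Fin (n + 3)) : i + 1 ≠ i := by
  rw [Ne, add_eq_left]
  exact Fin.zero_ne_one.symm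

theorem fin_add_one_add_one_ne (i : Fin (n + 3)) : i + 1 + 1 ≠ i := by
  rw [Ne, add_assoc, add_eq_left, Fin.ext_iff]
  simp [Fin.val_add, Nat.mod_eq_of_lt (show 1 + 1 < n + 3 by omega)]

theorem latticeDet_side_nonneg (i j : Fin (n + 3)) :
    0 ≤ latticeDet (P.side i) (P.vertex j - P.vertex i) := by
  by_cases h1 : j = i
  · simp [h1, latticeDet]
  by_cases h2 : j = i + 1
  · rw [h2]; exact (latticeDet_self (P.side i)).ge
  · exact (P.convex i j h1 h2).le

theorem vertex_injective : Function.Injective P.vertex := by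
  intro i j hij
  by_contra hne
  by_cases h : j = i + 1
  · have h2 := P.convex i (i + 1 + 1) (fin_add_one_add_one_ne i) (fin_add_one_ne (i + 1))
    rw [← h, ← hij] at h2
    simp [latticeDet] at h2
  · have h2 := P.convex i j (Ne.symm hne) h
    rw [← hij] at h2
    simp [latticeDet] at h2

theorem vertex_mem_latticePoints (i : Fin (n + 3)) : P.vertex i ∈ P.latticePoints := by
  rw [latticePoints, Finset.mem_filter, box, Finset.mem_Icc]
  exact ⟨⟨Finset.inf'_le _ (Finset.mem_univ i), Finset.le_sup' _ (Finset.mem_univ i)⟩,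
    fun j => P.latticeDet_side_nonneg j i⟩

/-- The vertices already give three points. This supplies the bound `3 ≤ c` behind the ratio `5 /
6`. -/
theorem three_le_card_latticePoints : 3 ≤ P.latticePoints.card := by
  have h := Finset.card_le_card_of_injOn (s := Finset.univ) (t := P.latticePoints) P.vertex
    (fun i _ => P.vertex_mem_latticePoints i) P.vertex_injective.injOn
  rw [Finset.card_univ, Fintype.card_fin] at h
  omega

theorem interiorPoints_subset : P.interiorPoints ⊆ P.latticePoints := fun q hq => by
  rw [interiorPoints, Finset.mem_filter] at hq
  rw [latticePoints, Finset.mem_filter]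
  exact ⟨hq.1, fun i => (hq.2 i).le⟩

theorem sideLength_smul_sideDir (i : Fin (n + 3)) : P.sideLength i • P.sideDir i = P.side i := by
  apply Prod.ext
  · simp only [sideDir, Prod.smul_fst]
    rw [nsmul_eq_mul]
    exact Int.mul_ediv_cancel' (Int.gcd_dvd_left _ _)
  · simp only [sideDir, Prod.smul_snd]
    rw [nsmul_eq_mul]
    exact Int.mul_ediv_cancel' (Int.gcd_dvd_right _ _)

theorem sideLength_pos (i : Fin (n + 3)) : 0 < P.sideLength i := by
  rw [Nat.pos_iff_ne_zero]
  intro h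
  have h1 := P.sideLength_smul_sideDir i
  rw [h, zero_smul] at h1
  exact fin_add_one_ne i (P.vertex_injective (sub_eq_zero.1 h1.symm))

/-- An additive function on the points of a side is a convex combination of its values at the
ends. -/
theorem sideLength_mul_map (i : Fin (n + 3)) (L : ℤ × ℤ →+ ℤ) (p : ℤ × ℤ) (k : ℕ) :
    P.sideLength i * L (P.vertex i + k • P.sideDir i - p) =
      (P.sideLength i - k) * L (P.vertex i - p) + k * L (P.vertex (i + 1) - p) := by
  have h1 : L (P.vertex (i + 1) - p) = L (P.vertex i - p) + P.sideLength i * L (P.sideDir i) := by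
    rw [← nsmul_eq_mul, ← map_nsmul, sideLength_smul_sideDir, ← map_add, side]
    congr 1; abel
  have h2 : L (P.vertex i + k • P.sideDir i - p) = L (P.vertex i - p) + k * L (P.sideDir i) := by
    rw [← nsmul_eq_mul, ← map_nsmul, ← map_add]
    congr 1; abel
  rw [h1, h2]; ring

/-- `latticeDet a` as an additive map. -/
def latticeDetLeft (a : ℤ × ℤ) : ℤ × ℤ →+ ℤ where
  toFun := latticeDet a
  map_zero' := by simp [latticeDet]
  map_add' p q := by simp only [latticeDet, Prod.fst_add, Prod.snd_add]; ring

theorem latticeDetLeft_neg (v p : ℤ × ℤ) : latticeDetLeft (-v) p = latticeDet p v := by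
  simp only [latticeDetLeft, latticeDet, AddMonoidHom.coe_mk, ZeroHom.coe_mk, Prod.fst_neg,
    Prod.snd_neg]
  ring

variable {P}

namespace CornerFrame

variable {m : Fin (n + 3)} (F : P.CornerFrame m)

/-- The first coordinate of a lattice point. -/
def fst (q : ℤ × ℤ) : ℤ := latticeDet (q - P.vertex m) F.v

/-- The second coordinate of a lattice point. -/
def snd (q : ℤ × ℤ) : ℤ := latticeDet F.u (q - P.vertex m)

theorem side_eq : P.side m = P.sideLength m • F.u := by
  rw [F.u_eq, sideLength_smul_sideDir]

theorem latticeDet_side (q : ℤ × ℤ) :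
    latticeDet (P.side m) (q - P.vertex m) = P.sideLength m * F.snd q := by
  rw [F.side_eq]
  simp only [latticeDet, snd, Prod.smul_fst, Prod.smul_snd]
  simp only [nsmul_eq_mul]
  ring

theorem snd_pos_of_latticeDet_pos {q : ℤ × ℤ}
    (h : 0 < latticeDet (P.side m) (q - P.vertex m)) : 0 < F.snd q := by
  rw [F.latticeDet_side] at h
  exact pos_of_mul_pos_right h (Int.natCast_nonneg _)

theorem snd_vertex_nonneg (i : Fin (n + 3)) : 0 ≤ F.snd (P.vertex i) := by
  have h := P.latticeDet_side_nonneg m i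
  rw [F.latticeDet_side] at h
  exact nonneg_of_mul_nonneg_right h (by exact_mod_cast P.sideLength_pos m)

theorem snd_vertex_pos {i : Fin (n + 3)} (h₁ : i ≠ m) (h₂ : i ≠ m + 1) :
    0 < F.snd (P.vertex i) :=
  F.snd_pos_of_latticeDet_pos (P.convex m i h₁ h₂)

theorem fst_side_nonneg (i : Fin (n + 3)) {k : ℕ} (hk : k < P.sideLength i) :
    0 ≤ F.fst (P.vertex i + k • P.sideDir i) := by
  have h := P.sideLength_mul_map i (latticeDetLeft (-F.v)) (P.vertex m) k
  simp only [latticeDetLeft_neg] at h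
  have h1 := F.nonneg i
  have h2 := F.nonneg (i + 1)
  have h3 : (0 : ℤ) ≤ P.sideLength i - k := by omega
  refine nonneg_of_mul_nonneg_right (a := (P.sideLength i : ℤ)) ?_ (by exact_mod_cast P.sideLength_pos i)
  rw [fst, h]
  positivity

/-- The second coordinate is a convex combination of those of the ends. The start has positive
weight and height unless it is `vertex (m + 1)`; in that case `k > 0` brings in the other end, which
lies off the line of side `m`. -/
theorem snd_side_pos {i : Fin (n + 3)} (hi : i ≠ m) {k : ℕ} (hk : k < P.sideLength i)
    (hik : ¬(i = m + 1 ∧ k = 0)) : 0 < F.snd (P.vertex i + k • P.sideDir i) := by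
  have h := P.sideLength_mul_map i (latticeDetLeft F.u) (P.vertex m) k
  have h1 := F.snd_vertex_nonneg i
  have h2 := F.snd_vertex_nonneg (i + 1)
  have h3 : (0 : ℤ) < P.sideLength i - k := by omega
  refine pos_of_mul_pos_right (a := (P.sideLength i : ℤ)) ?_ (Int.natCast_nonneg _)
  change _ = _ * F.snd (P.vertex i) + _ * F.snd (P.vertex (i + 1)) at h
  change 0 < _ * latticeDetLeft F.u _
  rw [h]
  by_cases him : i = m + 1
  · have hk0 : (0 : ℤ) < k := by have : k ≠ 0 := fun h0 => hik ⟨him, h0⟩; omega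
    have h4 : 0 < F.snd (P.vertex (i + 1)) := F.snd_vertex_pos
      (by rw [him]; exact fin_add_one_add_one_ne m) (by rw [him]; exact fin_add_one_ne _)
    positivity
  · have h4 : 0 < F.snd (P.vertex i) := F.snd_vertex_pos hi him
    positivity

theorem snd_interior_pos {q : ℤ × ℤ} (hq : q ∈ P.interiorPoints) : 0 < F.snd q :=
  F.snd_pos_of_latticeDet_pos ((Finset.mem_filter.1 hq).2 m)

/-- Strictness comes from the side that enters `vertex m`: its start has positive second and
nonnegative first coordinate, and `q` lies strictly to its left. -/
theorem fst_interior_pos {q : ℤ × ℤ} (hq : q ∈ P.interiorPoints) : 0 < F.fst q := by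
  obtain ⟨i, hi⟩ : ∃ i : Fin (n + 3), i + 1 = m := ⟨m - 1, sub_add_cancel m 1⟩
  have h0 := (Finset.mem_filter.1 hq).2 i
  have ht := F.snd_interior_pos hq
  have hb : 0 < F.snd (P.vertex i) := F.snd_vertex_pos
    (by rw [← hi]; exact (fin_add_one_ne i).symm)
    (by rw [← hi]; exact (fin_add_one_add_one_ne i).symm)
  have ha : 0 ≤ F.fst (P.vertex i) := F.nonneg i
  have key : latticeDet (P.side i) (q - P.vertex i) =
      F.snd (P.vertex i) * F.fst q - F.fst (P.vertex i) * F.snd q := by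
    have hd := F.det_eq_one
    simp only [side, hi, fst, snd, latticeDet, Prod.fst_sub, Prod.snd_sub] at hd ⊢
    linear_combination (-((P.vertex m).1 - (P.vertex i).1) * (q.2 - (P.vertex m).2) +
      ((P.vertex m).2 - (P.vertex i).2) * (q.1 - (P.vertex m).1)) * hd
  rw [key] at h0
  have h1 : 0 < F.snd (P.vertex i) * F.fst q := by nlinarith [mul_nonneg ha ht.le]
  exact pos_of_mul_pos_right h1 hb.le

theorem eq_of_coords (q : ℤ × ℤ) : q = P.vertex m + F.fst q • F.u + F.snd q • F.v :=
  eq_add_smul_add_smul F.det_eq_one _ q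

theorem three_le_fst_add_snd {q : ℤ × ℤ} (hq : q ∈ P.interiorPoints)
    (hne : q ≠ P.vertex m + F.u + F.v) : 3 ≤ F.fst q + F.snd q := by
  have h1 := F.fst_interior_pos hq
  have h2 := F.snd_interior_pos hq
  by_contra hlt
  have h3 : F.fst q = 1 := by omega
  have h4 : F.snd q = 1 := by omega
  refine hne ?_
  conv_lhs => rw [F.eq_of_coords q, h3, h4, one_smul, one_smul]

end CornerFrame

end polygon

/-! ### The family of curves in the coordinates of the corner. -/

section family

variable {n : ℕ} {P : LatticePolygon n} {m : Fin (n + 3)} (F : P.CornerFrame m)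

/-- The boundary points off the side that leaves `vertex m`, as pairs of a side and the position
on it. -/
noncomputable def farBoundary (P : LatticePolygon n) (m : Fin (n + 3)) :
    Finset (Σ _ : Fin (n + 3), ℕ) :=
  ((Finset.univ.erase m).sigma fun i => Finset.range (P.sideLength i)).erase ⟨m + 1, 0⟩

/-- The family in the toric coordinates at `vertex m`, without the term of the node. -/
noncomputable def CornerFrame.rest (lam : P.interiorPoints → ℂ) (X Y : ℂ) : ℂ :=
  (1 + X) ^ P.sideLength m +
    ∑ b ∈ farBoundary P m, ((P.sideLength b.1).choose b.2 : ℂ) *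
      (X ^ (F.fst (P.vertex b.1 + b.2 • P.sideDir b.1)).toNat *
        Y ^ ((F.snd (P.vertex b.1 + b.2 • P.sideDir b.1) - 1).toNat + 1)) -
    ∑ j ∈ Finset.univ.erase F.node, lam j *
      (X ^ (F.fst j).toNat * Y ^ ((F.snd j - 1).toNat + 1))

theorem mem_farBoundary {b : Σ _ : Fin (n + 3), ℕ} :
    b ∈ farBoundary P m ↔ ¬(b.1 = m + 1 ∧ b.2 = 0) ∧ b.1 ≠ m ∧ b.2 < P.sideLength b.1 := by
  obtain ⟨i, k⟩ := b
  simp only [farBoundary, Finset.mem_erase, Finset.mem_sigma, Finset.mem_univ, and_true,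
    Finset.mem_range, Ne, Sigma.mk.injEq, heq_eq_eq]

/-- Natural exponents make `rest` a polynomial, defined also at `Y = 0`, and the shift by one
displays divisibility by `Y`. -/
theorem CornerFrame.zpow_eq {X Y : ℂ} {q : ℤ × ℤ} (h₁ : 0 ≤ F.fst q) (h₂ : 0 < F.snd q) :
    X ^ F.fst q * Y ^ F.snd q = X ^ (F.fst q).toNat * Y ^ ((F.snd q - 1).toNat + 1) := by
  rw [← zpow_natCast, ← zpow_natCast]
  congr 2 <;> omega

/-- There is `ε₀` below which the node dominates the rest of the family. -/
theorem CornerFrame.exists_nodeDominated_rest :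
    ∃ ε₀ : ℝ, 0 < ε₀ ∧ ∀ ε : ℝ, 0 < ε → ε < ε₀ → ∀ lam : P.interiorPoints → ℂ,
      (P.latticePoints.card : ℝ) / ε ^ 2 < ‖lam F.node‖ →
      (∀ j, j ≠ F.node → ‖lam j‖ < 1 / (P.latticePoints.card * ε ^ 3)) →
      NodeDominated (F.rest lam) (P.sideLength m) (lam F.node) ε (5 / 6) := by
  obtain ⟨ε₀, h0, h⟩ := exists_nodeDominated (P.sideLength m) (farBoundary P m)
    (fun b => ((P.sideLength b.1).choose b.2 : ℂ))
    (fun b => (F.fst (P.vertex b.1 + b.2 • P.sideDir b.1)).toNat)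
    (fun b => (F.snd (P.vertex b.1 + b.2 • P.sideDir b.1) - 1).toNat)
    (Finset.univ.erase F.node) (fun j => (F.fst j).toNat) (fun j => (F.snd j - 1).toNat)
    (fun j _ => by have := F.fst_interior_pos j.2; omega)
    (fun j hj => by
      have h1 := F.fst_interior_pos j.2
      have h2 := F.snd_interior_pos j.2
      have h3 := F.three_le_fst_add_snd j.2
        (fun h => (Finset.mem_erase.1 hj).1 (Subtype.ext h))
      omega)
    (c := P.latticePoints.card) (by exact_mod_cast P.three_le_card_latticePoints)
    (by
      have h1 := Finset.card_le_card P.interiorPoints_subset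
      have h2 : (Finset.univ.erase F.node).card ≤ P.interiorPoints.card :=
        (Finset.card_erase_le).trans_eq (by rw [Finset.card_univ, Fintype.card_coe])
      exact_mod_cast h2.trans h1)
  exact ⟨ε₀, h0, fun ε hε hlt lam hl hj =>
    h ε hε hlt (lam F.node) lam hl fun j hj' => hj j (Finset.mem_erase.1 hj').1⟩

theorem CornerFrame.fst_node : F.fst F.node = 1 := by
  have := F.det_eq_one
  simp only [fst, node, latticeDet, Prod.fst_sub, Prod.snd_sub, Prod.fst_add, Prod.snd_add] at this ⊢
  linear_combination this

theorem CornerFrame.snd_node : F.snd F.node = 1 := by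
  have := F.det_eq_one
  simp only [snd, node, latticeDet, Prod.fst_sub, Prod.snd_sub, Prod.fst_add, Prod.snd_add] at this ⊢
  linear_combination this

theorem CornerFrame.coords_side (k : ℕ) :
    F.fst (P.vertex m + k • P.sideDir m) = k ∧ F.snd (P.vertex m + k • P.sideDir m) = 0 := by
  have := F.det_eq_one
  rw [← F.u_eq]
  simp only [fst, snd, latticeDet, Prod.fst_sub, Prod.snd_sub, Prod.fst_add, Prod.snd_add,
    Prod.smul_fst, Prod.smul_snd] at this ⊢
  simp only [nsmul_eq_mul]
  exact ⟨by linear_combination (k : ℤ) * this, by ring⟩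

/-- Side `m` lists its points without the last one, which is `⟨m + 1, 0⟩`, the first point of the
next side. Moving that term over completes the binomial expansion of `(1 + X) ^ κ`. -/
theorem CornerFrame.boundary_sum {X Y : ℂ} :
    ∑ i, ∑ k ∈ Finset.range (P.sideLength i), ((P.sideLength i).choose k : ℂ) *
      (X ^ F.fst (P.vertex i + k • P.sideDir i) * Y ^ F.snd (P.vertex i + k • P.sideDir i)) =
    (1 + X) ^ P.sideLength m +
    ∑ b ∈ farBoundary P m, ((P.sideLength b.1).choose b.2 : ℂ) *
      (X ^ (F.fst (P.vertex b.1 + b.2 • P.sideDir b.1)).toNat *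
        Y ^ ((F.snd (P.vertex b.1 + b.2 • P.sideDir b.1) - 1).toNat + 1)) := by
  set f : (Σ _ : Fin (n + 3), ℕ) → ℂ := fun b => ((P.sideLength b.1).choose b.2 : ℂ) *
      (X ^ F.fst (P.vertex b.1 + b.2 • P.sideDir b.1) *
        Y ^ F.snd (P.vertex b.1 + b.2 • P.sideDir b.1)) with hf
  have hmem : (⟨m + 1, 0⟩ : Σ _ : Fin (n + 3), ℕ) ∈
      (Finset.univ.erase m).sigma fun i => Finset.range (P.sideLength i) := by
    simp [P.sideLength_pos]
  have hlast : f ⟨m + 1, 0⟩ = X ^ P.sideLength m := by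
    have hv : P.vertex (m + 1) = P.vertex m + P.sideLength m • P.sideDir m := by
      rw [sideLength_smul_sideDir, side]; abel
    simp [-nsmul_eq_mul, hf, hv, (F.coords_side _).1, (F.coords_side _).2]
  have hm : ∑ k ∈ Finset.range (P.sideLength m), f ⟨m, k⟩ =
      ∑ k ∈ Finset.range (P.sideLength m), X ^ k * ((P.sideLength m).choose k : ℂ) := by
    refine Finset.sum_congr rfl fun k _ => ?_
    simp [-nsmul_eq_mul, hf, (F.coords_side _).1, (F.coords_side _).2, mul_comm]
  have hfar : ∑ b ∈ farBoundary P m, f b = ∑ b ∈ farBoundary P m,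
      ((P.sideLength b.1).choose b.2 : ℂ) *
      (X ^ (F.fst (P.vertex b.1 + b.2 • P.sideDir b.1)).toNat *
        Y ^ ((F.snd (P.vertex b.1 + b.2 • P.sideDir b.1) - 1).toNat + 1)) := by
    refine Finset.sum_congr rfl fun b hb => ?_
    obtain ⟨h1, h2, h3⟩ := mem_farBoundary.1 hb
    rw [← F.zpow_eq (F.fst_side_nonneg _ h3) (F.snd_side_pos h2 h3 h1)]
  rw [← hfar]
  change ∑ i, ∑ k ∈ Finset.range (P.sideLength i), f ⟨i, k⟩ = _
  rw [← Finset.add_sum_erase _ _ (Finset.mem_univ m), hm,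
    ← Finset.sum_sigma (f := f), ← Finset.add_sum_erase _ _ hmem, hlast, add_comm 1 X, add_pow,
    Finset.sum_range_succ]
  simp [farBoundary, add_assoc]

variable {z : ℂ × ℂ}

theorem CornerFrame.monomialAt_eq (h₁ : z.1 ≠ 0) (h₂ : z.2 ≠ 0) (q : ℤ × ℤ) :
    monomialAt q z = monomialAt (P.vertex m) z *
      (monomialAt F.u z ^ F.fst q * monomialAt F.v z ^ F.snd q) :=
  monomialAt_eq_mul F.det_eq_one h₁ h₂ _ q

/-- The family in toric coordinates. -/
theorem CornerFrame.laurentEval_familyPoly (lam : P.interiorPoints → ℂ) (h₁ : z.1 ≠ 0)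
    (h₂ : z.2 ≠ 0) : laurentEval (P.familyPoly lam) z = monomialAt (P.vertex m) z *
      (F.rest lam (monomialAt F.u z) (monomialAt F.v z) -
        lam F.node * monomialAt F.u z * monomialAt F.v z) := by
  have e1 : ∀ c q, c * monomialAt q z = monomialAt (P.vertex m) z *
      (c * (monomialAt F.u z ^ F.fst q * monomialAt F.v z ^ F.snd q)) := fun c q => by
    rw [F.monomialAt_eq h₁ h₂ q]; ring
  rw [← laurentEvalHom_apply h₁ h₂, familyPoly, boundaryPoly]
  simp only [map_sub, map_sum, laurentEvalHom_apply, laurentEval_monomial]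
  generalize monomialAt (P.vertex m) z = M at e1 ⊢
  generalize monomialAt F.u z = U at e1 ⊢
  generalize monomialAt F.v z = V at e1 ⊢
  simp only [e1, ← Finset.mul_sum]
  rw [F.boundary_sum, ← mul_sub, ← Finset.add_sum_erase _ _ (Finset.mem_univ F.node),
    F.fst_node, F.snd_node]
  have e2 : ∑ j ∈ Finset.univ.erase F.node, lam j * (U ^ F.fst j * V ^ F.snd j) =
      ∑ j ∈ Finset.univ.erase F.node, lam j *
      (U ^ (F.fst j).toNat * V ^ ((F.snd j - 1).toNat + 1)) :=
    Finset.sum_congr rfl fun j _ => by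
      rw [F.zpow_eq (F.fst_interior_pos j.2).le (F.snd_interior_pos j.2)]
  rw [e2, rest, zpow_one, zpow_one]
  ring

theorem CornerFrame.mem_curve_iff (lam : P.interiorPoints → ℂ) :
    z ∈ P.curve lam ↔ z.1 ≠ 0 ∧ z.2 ≠ 0 ∧
      lam F.node * monomialAt F.u z * monomialAt F.v z =
        F.rest lam (monomialAt F.u z) (monomialAt F.v z) := by
  rw [curve, Set.mem_ofPred_eq]
  refine and_congr_right fun h₁ => and_congr_right fun h₂ => ?_
  rw [F.laurentEval_familyPoly lam h₁ h₂, mul_eq_zero, or_iff_right (monomialAt_ne_zero h₁ h₂ _),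
    sub_eq_zero, eq_comm]

/-- Dividing `Φ` by `λ` times the monomial of the node leaves `rest / (λ X Y) - 1`, and the summand
`λ` in `Ψ` removes the `-1`. -/
theorem CornerFrame.laurentEval_psi_pow (lam : P.interiorPoints → ℂ) (hl : lam F.node ≠ 0)
    {X Y : ℂ} (hX : X ≠ 0) (hY : Y ≠ 0) (k : ℕ) :
    laurentEval (P.psi lam F.node ^ k) (toricPoint F.u F.v X Y) =
      (F.rest lam X Y / (lam F.node * X * Y)) ^ k := by
  set z := toricPoint F.u F.v X Y with hz
  have h₁ : z.1 ≠ 0 := toricPoint_fst_ne_zero hX hY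
  have h₂ : z.2 ≠ 0 := toricPoint_snd_ne_zero hX hY
  have hXz : monomialAt F.u z = X := monomialAt_toricPoint_left F.det_eq_one hX hY
  have hYz : monomialAt F.v z = Y := monomialAt_toricPoint_right F.det_eq_one hX hY
  have hnode : monomialAt (-(F.node : ℤ × ℤ)) z * monomialAt (P.vertex m) z * (X * Y) = 1 := by
    have := F.monomialAt_eq h₁ h₂ F.node
    rw [F.fst_node, F.snd_node, hXz, hYz, zpow_one, zpow_one] at this
    rw [mul_assoc, ← this, ← monomialAt_add h₁ h₂, neg_add_cancel]
    simp [monomialAt]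
  rw [← laurentEvalHom_apply h₁ h₂, map_pow, psi, map_smul, map_add, map_mul]
  simp only [laurentEvalHom_apply, laurentEval_monomial, F.laurentEval_familyPoly lam h₁ h₂, hXz, hYz]
  congr 1
  have h0 : monomialAt 0 z = 1 := by simp [monomialAt]
  rw [h0, smul_eq_mul, eq_div_iff (mul_ne_zero (mul_ne_zero hl hX) hY)]
  field_simp
  linear_combination (F.rest lam X Y - lam F.node * X * Y) * hnode

/-- The sum of the constant terms of the powers of `Ψ`. -/
theorem CornerFrame.hasSum_constantTerm (lam : P.interiorPoints → ℂ) {κ : ℕ} {ε ρ : ℝ}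
    (h : NodeDominated (F.rest lam) κ (lam F.node) ε ρ) :
    HasSum (fun k : ℕ => 1 / ((k : ℂ) + 1) * constantTerm (P.psi lam F.node ^ (k + 1)))
      (∫ t in (0 : ℝ)..1, NodeDominated.logNode (F.rest lam) κ (lam F.node) ε t) := by
  convert! h.hasSum_integral_logNode using 3 with k
  rw [← torusMean_laurentEval F.det_eq_one h.pos]
  exact torusMean_congr h.pos fun X Y hX hY => F.laurentEval_psi_pow lam h.lam_ne_zero
    (norm_pos_iff.1 (hX ▸ h.pos)) (norm_pos_iff.1 (hY ▸ h.pos)) _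

end family

end LatticePolygon

end

section

/-! ## The regulator along the vanishing cycle -/

open Set Filter Topology

section assembly

open Complex
open scoped Real

/-- Writing `t M'` as `(t M)' - M` makes the integrand an exact derivative plus a multiple of `M`,
with an antisymmetric coefficient that later becomes `det(u, v)`. -/
theorem integral_mul_deriv_of_affine_add {M : ℝ → ℂ} (hM : ContDiff ℝ 1 M) (hM1 : M 1 = M 0)
    (a b c a' b' c' w : ℂ) :
    ∫ t in (0 : ℝ)..1, (a + b * w * t + c * M t) * deriv (fun t : ℝ => a' + b' * w * t + c' * M t) t =
      a * b' * w + b * b' * w ^ 2 / 2 + b * c' * w * M 0 +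
        (c * b' - b * c') * w * ∫ t in (0 : ℝ)..1, M t := by
  have hMd : ∀ t, HasDerivAt M (deriv M t) t := fun t =>
    ((hM.differentiable one_ne_zero) t).hasDerivAt
  have hid : ∀ t : ℝ, HasDerivAt (fun t : ℝ => (t : ℂ)) 1 t := fun t => by
    simpa using (hasDerivAt_id t).ofReal_comp
  have hcM := hM.continuous
  have hcM' : Continuous (deriv M) := hM.continuous_deriv le_rfl
  have hg : ∀ t, deriv (fun t : ℝ => a' + b' * w * t + c' * M t) t = b' * w + c' * deriv M t :=
    fun t => by
      have := (((hid t).const_mul (b' * w)).const_add a').add ((hMd t).const_mul c')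
      rw [mul_one] at this
      exact this.deriv
  set p : ℝ → ℂ := fun t =>
    a * b' * w * t + b * b' * w ^ 2 / 2 * (t * t) + a * c' * M t + b * c' * w * (t * M t) +
      c * c' / 2 * (M t * M t) with hp
  set p' : ℝ → ℂ := fun t =>
    a * b' * w * 1 + b * b' * w ^ 2 / 2 * (1 * t + t * 1) + a * c' * deriv M t +
      b * c' * w * (1 * M t + t * deriv M t) + c * c' / 2 * (deriv M t * M t + M t * deriv M t)
      with hp'
  have hpd : ∀ t, HasDerivAt p (p' t) t := fun t =>
    (((((hid t).const_mul _).add (((hid t).mul (hid t)).const_mul _)).add ((hMd t).const_mul _)).add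
      (((hid t).mul (hMd t)).const_mul _)).add (((hMd t).mul (hMd t)).const_mul _)
  have hp'c : Continuous p' := by
    have := continuous_ofReal
    fun_prop
  have hint := intervalIntegral.integral_eq_sub_of_hasDerivAt (fun t _ => hpd t)
    (hp'c.intervalIntegrable 0 1)
  have hsplit : ∀ t : ℝ, (a + b * w * t + c * M t) *
      deriv (fun t : ℝ => a' + b' * w * t + c' * M t) t =
      p' t + (c * b' - b * c') * w * M t := fun t => by
    rw [hg, hp']; ring
  simp only [hsplit]
  rw [intervalIntegral.integral_add (hp'c.intervalIntegrable _ _)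
    (g := fun t => (c * b' - b * c') * w * M t)
    ((continuous_const.mul hcM).intervalIntegrable _ _), hint,
    intervalIntegral.integral_const_mul, hp]
  simp only [hM1, ofReal_one, ofReal_zero]
  ring

/-- The summand `πi` absorbs the signs in the symbol `{-x, -y}`. -/
theorem toricPoint_exp (u v : ℤ × ℤ) (A B : ℂ) :
    toricPoint u v (exp A) (exp B) =
      (-exp (π * I + v.2 * A - u.2 * B), -exp (π * I - v.1 * A + u.1 * B)) := by
  have e : ∀ W : ℂ, -exp (π * I + W) = exp W := fun W => by
    rw [exp_add, exp_pi_mul_I, neg_one_mul, neg_neg]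
  rw [add_sub_assoc, e, sub_add_eq_add_sub, add_sub_assoc, e]
  simp only [toricPoint, ← exp_int_mul, ← exp_add]
  congr 2 <;> (push_cast; ring)

/-- If both coordinates of `u + v` were even, then `u ≡ v` modulo `2` and the determinant would be
even. The parity fixes the sign in `log (-lam)`. -/
theorem odd_of_latticeDet_eq_one {u v : ℤ × ℤ} (h : latticeDet u v = 1) :
    Odd (u.1 + v.1 + (u.2 + v.2) - (u.1 + v.1) * (u.2 + v.2)) := by
  have e : u.1 + v.1 + (u.2 + v.2) - (u.1 + v.1) * (u.2 + v.2) =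
      1 - (1 - (u.1 + v.1)) * (1 - (u.2 + v.2)) := by ring
  rw [e]
  refine Odd.sub_even odd_one (Int.even_mul.2 ?_)
  by_contra! hcon
  simp only [Int.not_even_iff_odd] at hcon
  obtain ⟨⟨r, hr⟩, ⟨s, hs⟩⟩ := hcon
  have h2 : 2 * (u.2 * r - u.1 * s) = 1 := by
    simp only [latticeDet] at h
    linear_combination h - u.2 * hr + u.1 * hs
  omega

/-- The logarithm of `X` along the circle `|X| = ε`. -/
noncomputable def logX (ε t : ℝ) : ℂ := Real.log ε - 2 * π * I * t

theorem exp_logX {ε : ℝ} (hε : 0 < ε) (t : ℝ) : exp (logX ε t) = clockwise ε t := by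
  rw [logX, sub_eq_add_neg, exp_add, ← ofReal_exp, Real.exp_log hε, clockwise]
  congr 3; ring

namespace NodeDominated

variable {Q : ℂ → ℂ → ℂ} {κ : ℕ} {lam : ℂ} {ε ρ : ℝ}

/-- The logarithm of `Y` along the curve. -/
noncomputable def logY (Q : ℂ → ℂ → ℂ) (κ : ℕ) (lam : ℂ) (ε t : ℝ) : ℂ :=
  logNode Q κ lam ε t - log lam - logX ε t

theorem exp_logY (h : NodeDominated Q κ lam ε ρ) (t : ℝ) :
    exp (logY Q κ lam ε t) = exp (logNode Q κ lam ε t) / (lam * clockwise ε t) := by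
  rw [logY, exp_sub, exp_sub, exp_logX h.pos, exp_log h.lam_ne_zero, div_div]

theorem norm_exp_logY_lt (h : NodeDominated Q κ lam ε ρ) (t : ℝ) :
    ‖exp (logY Q κ lam ε t)‖ < ε := by
  rw [h.exp_logY]; exact h.exp_logNode_div.1

theorem exp_logY_root (h : NodeDominated Q κ lam ε ρ) (t : ℝ) :
    lam * clockwise ε t * exp (logY Q κ lam ε t) = Q (clockwise ε t) (exp (logY Q κ lam ε t)) := by
  rw [h.exp_logY]; exact h.exp_logNode_div.2

theorem exp_logY_eq (h : NodeDominated Q κ lam ε ρ) {t : ℝ} {Y : ℂ} (hY : ‖Y‖ ≤ ε)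
    (e : lam * clockwise ε t * Y = Q (clockwise ε t) Y) : exp (logY Q κ lam ε t) = Y :=
  h.root_unique (norm_clockwise h.pos t) (h.norm_exp_logY_lt t).le hY (h.exp_logY_root t) e

end NodeDominated

open NodeDominated

/-- The curve over the circle `|X| = ε`, in terms of the logarithms of `X` and `Y`. -/
noncomputable def liftedLoop (u v : ℤ × ℤ) (Q : ℂ → ℂ → ℂ) (κ : ℕ) (lam : ℂ) (ε t : ℝ) : ℂ × ℂ :=
  (π * I + v.2 * logX ε t - u.2 * logY Q κ lam ε t,
    π * I - v.1 * logX ε t + u.1 * logY Q κ lam ε t)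

variable {u v : ℤ × ℤ} {Q : ℂ → ℂ → ℂ} {κ : ℕ} {lam : ℂ} {ε ρ : ℝ}

theorem toricPoint_eq_exp_liftedLoop (h : NodeDominated Q κ lam ε ρ) (t : ℝ) :
    toricPoint u v (clockwise ε t) (exp (logY Q κ lam ε t)) =
      (-exp (liftedLoop u v Q κ lam ε t).1, -exp (liftedLoop u v Q κ lam ε t).2) := by
  rw [← exp_logX h.pos, toricPoint_exp, liftedLoop]

theorem contDiff_logX (ε : ℝ) : ContDiff ℝ 1 (logX ε) := by
  unfold logX
  exact contDiff_const.sub (contDiff_const.mul ofRealCLM.contDiff)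

theorem contDiff_logY (h : NodeDominated Q κ lam ε ρ) : ContDiff ℝ 1 (logY Q κ lam ε) :=
  (h.contDiff_logNode.sub contDiff_const).sub (contDiff_logX ε)

theorem contDiff_liftedLoop_fst (h : NodeDominated Q κ lam ε ρ) :
    ContDiff ℝ 1 fun t => (liftedLoop u v Q κ lam ε t).1 :=
  (contDiff_const.add (contDiff_const.mul (contDiff_logX ε))).sub
    (contDiff_const.mul (contDiff_logY h))

theorem contDiff_liftedLoop_snd (h : NodeDominated Q κ lam ε ρ) :
    ContDiff ℝ 1 fun t => (liftedLoop u v Q κ lam ε t).2 :=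
  (contDiff_const.sub (contDiff_const.mul (contDiff_logX ε))).add
    (contDiff_const.mul (contDiff_logY h))

theorem logX_add_one (ε t : ℝ) : logX ε (t + 1) = logX ε t - 2 * π * I := by
  simp only [logX]; push_cast; ring

theorem logY_add_one (t : ℝ) : logY Q κ lam ε (t + 1) = logY Q κ lam ε t + 2 * π * I := by
  simp only [logY, logX_add_one, logNode_periodic]; ring

theorem liftedLoop_fst_add_one (t : ℝ) : (liftedLoop u v Q κ lam ε (t + 1)).1 =
    (liftedLoop u v Q κ lam ε t).1 + 2 * π * I * ((-(u.2 + v.2) : ℤ) : ℂ) := by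
  simp only [liftedLoop, logX_add_one, logY_add_one]; push_cast; ring

theorem liftedLoop_snd_add_one (t : ℝ) : (liftedLoop u v Q κ lam ε (t + 1)).2 =
    (liftedLoop u v Q κ lam ε t).2 + 2 * π * I * ((u.1 + v.1 : ℤ) : ℂ) := by
  simp only [liftedLoop, logX_add_one, logY_add_one]; push_cast; ring

/-- The regulator of the loop in terms of the mean of `log (lam X Y)` along it. -/
theorem regulatorIntegral_liftedLoop (huv : latticeDet u v = 1)
    (h : NodeDominated Q κ lam ε ρ) (a b : ℝ)
    (ha : CutTransverse a fun t => exp (liftedLoop u v Q κ lam ε t).1) :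
    ∃ k : ℤ, regulatorIntegral a b (fun t => exp (liftedLoop u v Q κ lam ε t).1)
        (fun t => exp (liftedLoop u v Q κ lam ε t).2) =
      2 * π * I * (-log (-lam) + ∫ t in (0 : ℝ)..1, logNode Q κ lam ε t) +
        k * (2 * π * I) ^ 2 := by
  obtain ⟨k, hk⟩ := regulatorIntegral_exp (contDiff_liftedLoop_fst h)
    (contDiff_liftedLoop_snd (u := u) (v := v) h)
    liftedLoop_fst_add_one liftedLoop_snd_add_one a b ha
  set M := logNode Q κ lam ε with hM
  have hM1 : M 1 = M 0 := by simpa using logNode_periodic (Q := Q) (κ := κ) (lam := lam) (ε := ε) 0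
  have e1 : ∀ t, (liftedLoop u v Q κ lam ε t).1 =
      (π * I + v.2 * Real.log ε + u.2 * (log lam + Real.log ε)) +
        (-(u.2 + v.2)) * (2 * π * I) * t + (-u.2) * M t := fun t => by
    simp only [liftedLoop, logY, logX, ← hM]; ring
  have e2 : ∀ t, (liftedLoop u v Q κ lam ε t).2 =
      (π * I - v.1 * Real.log ε - u.1 * (log lam + Real.log ε)) +
        (u.1 + v.1) * (2 * π * I) * t + u.1 * M t := fun t => by
    simp only [liftedLoop, logY, logX, ← hM]; ring
  have hI := integral_mul_deriv_of_affine_add h.contDiff_logNode hM1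
    (π * I + v.2 * Real.log ε + u.2 * (log lam + Real.log ε)) (-(u.2 + v.2)) (-u.2)
    (π * I - v.1 * Real.log ε - u.1 * (log lam + Real.log ε)) (u.1 + v.1) u.1 (2 * π * I)
  simp only [← hM, ← e1] at hI
  rw [← show (fun t => (liftedLoop u v Q κ lam ε t).2) = _ from funext e2] at hI
  obtain ⟨r, hr⟩ := odd_of_latticeDet_eq_one huv
  have hlog : exp (log (-lam)) = exp (log lam + π * I) := by
    rw [exp_log (neg_ne_zero.2 h.lam_ne_zero), exp_add, exp_log h.lam_ne_zero, exp_pi_mul_I]; ring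
  obtain ⟨s, hs⟩ := exp_eq_exp_iff_exists_int.1 hlog
  have hr' : ((u.1 : ℂ) + v.1 + (u.2 + v.2) - (u.1 + v.1) * (u.2 + v.2)) = 2 * r + 1 := by
    exact_mod_cast hr
  have hd : (u.1 : ℂ) * v.2 - u.2 * v.1 = 1 := by
    simp only [latticeDet] at huv
    exact_mod_cast huv
  -- The constants add up to `(2r + 1) · 2 (πi)²`; `s` is the ambiguity of `log (-lam)` against `log
  -- lam + πi`, and the `1` turns `2 (πi)²` into `-2 (πi)²`.
  refine ⟨k + r + s + 1, ?_⟩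
  rw [hk, hI, e2 0, hs]
  push_cast
  linear_combination (2 * π * I) * ((∫ t in (0 : ℝ)..1, M t) - log lam) * hd +
    2 * (π * I) ^ 2 * hr'

end assembly

/-! ### Existence and uniqueness of the vanishing cycle; the theorem. -/

section mainResult

open Complex NodeDominated LatticePolygon
open scoped Real

variable {n : ℕ} {P : LatticePolygon n} {m : Fin (n + 3)} (F : P.CornerFrame m)
  {lam : P.interiorPoints → ℂ} {κ : ℕ} {ε ρ : ℝ}

theorem exists_isVanishingCycle (h : NodeDominated (F.rest lam) κ (lam F.node) ε ρ) :
    ∃ γ : ℝ → ℂ × ℂ, IsVanishingCycle F lam ε γ := by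
  set y : ℝ → ℂ := fun t => exp (logY (F.rest lam) κ (lam F.node) ε t) with hy
  have hX := clockwise_ne_zero h.pos
  have hY : ∀ t, y t ≠ 0 := fun t => exp_ne_zero _
  refine ⟨fun t => toricPoint F.u F.v (clockwise ε t) (y t), ?_, fun t => ?_, fun t => ?_,
    fun t => ?_, fun t => ?_, fun z hz hzX hzY => ?_⟩
  · simp only [hy, toricPoint_eq_exp_liftedLoop h]
    exact (contDiff_liftedLoop_fst h).cexp.neg.prodMk (contDiff_liftedLoop_snd h).cexp.neg
  · have : y (t + 1) = y t := by
      simp only [hy, logY_add_one, exp_add, exp_two_pi_mul_I, mul_one]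
    simp only [clockwise_periodic, this]
  · refine (F.mem_curve_iff lam).2 ⟨toricPoint_fst_ne_zero (hX t) (hY t),
      toricPoint_snd_ne_zero (hX t) (hY t), ?_⟩
    rw [monomialAt_toricPoint_left F.det_eq_one (hX t) (hY t),
      monomialAt_toricPoint_right F.det_eq_one (hX t) (hY t)]
    exact h.exp_logY_root t
  · exact monomialAt_toricPoint_left F.det_eq_one (hX t) (hY t)
  · rw [monomialAt_toricPoint_right F.det_eq_one (hX t) (hY t)]
    exact h.norm_exp_logY_lt t
  · obtain ⟨h₁, h₂, e⟩ := (F.mem_curve_iff lam).1 hz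
    obtain ⟨t, ht⟩ := exists_clockwise_eq hzX
    refine ⟨t, ?_⟩
    rw [← ht] at e
    rw [show y t = _ from h.exp_logY_eq hzY e, ht, toricPoint_monomialAt F.det_eq_one h₁ h₂]

/-- The parametrization of `X` is prescribed, the root `Y` is unique, and toric coordinates
determine the point; so the explicit loop is the only vanishing cycle. -/
theorem LatticePolygon.IsVanishingCycle.eq_exp_liftedLoop {γ : ℝ → ℂ × ℂ}
    {F : P.CornerFrame m} (hγ : IsVanishingCycle F lam ε γ)
    (h : NodeDominated (F.rest lam) κ (lam F.node) ε ρ) (t : ℝ) :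
    γ t = (-exp (liftedLoop F.u F.v (F.rest lam) κ (lam F.node) ε t).1,
      -exp (liftedLoop F.u F.v (F.rest lam) κ (lam F.node) ε t).2) := by
  obtain ⟨h₁, h₂, e⟩ := (F.mem_curve_iff lam).1 (hγ.mem_curve t)
  have hX : monomialAt F.u (γ t) = clockwise ε t := hγ.fst_eq t
  rw [hX] at e
  rw [← toricPoint_eq_exp_liftedLoop h, h.exp_logY_eq (hγ.snd_lt t).le e, ← hX,
    toricPoint_monomialAt F.det_eq_one h₁ h₂]

end mainResult

end

theorem mainTheorem4 {n : ℕ} (P : LatticePolygon n) (m : Fin (n + 3)) (F : P.CornerFrame m) :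
    ∃ ε₀ : ℝ, 0 < ε₀ ∧ ∀ ε : ℝ, 0 < ε → ε < ε₀ → ∀ lam : P.interiorPoints → ℂ,
      (P.latticePoints.card : ℝ) / ε ^ 2 < ‖lam F.node‖ →
      (∀ j, j ≠ F.node → ‖lam j‖ < 1 / (P.latticePoints.card * ε ^ 3)) →
      Summable (fun k : ℕ => 1 / ((k : ℂ) + 1) * constantTerm (P.psi lam F.node ^ (k + 1))) ∧
      (∃ γ : ℝ → ℂ × ℂ, LatticePolygon.IsVanishingCycle F lam ε γ) ∧
      ∀ γ : ℝ → ℂ × ℂ, LatticePolygon.IsVanishingCycle F lam ε γ →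
        (∀ δ : ℝ, 0 < δ → ∃ a ∈ Set.Ioo 0 δ, CutTransverse a (fun t => -(γ t).1)) ∧
        ∀ a b : ℝ, CutTransverse a (fun t => -(γ t).1) →
          ((regulatorIntegral a b (fun t => -(γ t).1) (fun t => -(γ t).2) : ℂ) : ℂ ⧸ tateZ2) =
            ((2 * Real.pi * Complex.I * (-Complex.log (-lam F.node) +
              ∑' k : ℕ, 1 / ((k : ℂ) + 1) * constantTerm (P.psi lam F.node ^ (k + 1))) : ℂ) :
              ℂ ⧸ tateZ2) := by
  obtain ⟨ε₀, h0, hdom⟩ := F.exists_nodeDominated_rest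
  refine ⟨ε₀, h0, fun ε hε hlt lam hl hj => ?_⟩
  have h := hdom ε hε hlt lam hl hj
  have hsum := F.hasSum_constantTerm lam h
  refine ⟨hsum.summable, exists_isVanishingCycle F h, fun γ hγ => ?_⟩
  have e1 : (fun t => -(γ t).1) = fun t => Complex.exp
      (liftedLoop F.u F.v (F.rest lam) (P.sideLength m) (lam F.node) ε t).1 :=
    funext fun t => by rw [hγ.eq_exp_liftedLoop h t, neg_neg]
  have e2 : (fun t => -(γ t).2) = fun t => Complex.exp
      (liftedLoop F.u F.v (F.rest lam) (P.sideLength m) (lam F.node) ε t).2 :=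
    funext fun t => by rw [hγ.eq_exp_liftedLoop h t, neg_neg]
  rw [e1, e2]
  refine ⟨fun δ hδ => exists_cutTransverse_exp (contDiff_liftedLoop_fst h) hδ, fun a b ha => ?_⟩
  obtain ⟨k, hk⟩ := regulatorIntegral_liftedLoop F.det_eq_one h a b ha
  rw [hsum.tsum_eq, hk, QuotientAddGroup.eq]
  -- Equality of classes is tested on the right side minus the left, hence the sign.
  refine AddSubgroup.mem_zmultiples_iff.2 ⟨-k, ?_⟩
  rw [zsmul_eq_mul]
  push_cast
  ring
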